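/- Work with real vector fields on $\mathbb{R}^3$; curl $\nabla\wedge$, divergence $\nabla\cdot$ and gradient $\nabla$ are understood in the sense of distributions. Let $$\mathcal Y=\{A\in L^3(\mathbb{R}^3,\mathbb{R}^3):\ \nabla\wedge A\in L^{3/2}(\mathbb{R}^3,\mathbb{R}^3)\},$$ let $|\!|\!|A|\!|\!|_3=\inf_\phi\|A-\nabla\phi\|_3$, where the infimum is over all real $\phi\in L^1_{\rm loc}(\mathbb{R}^3)$ with $\nabla\phi\in L^3(\mathbb{R}^3,\mathbb{R}^3)$, and let $$S=\inf\left\{\frac{\|\nabla\wedge A\|_{3/2}^{3/2}}{|\!|\!|A|\!|\!|_3^{3/2}}:\ A\in\mathcal Y,\ |\!|\!|A|\!|\!|_3\neq0\right\}.$$ Let $(A_n)\subset\mathcal Y$ be a minimizing sequence for $S$ (that is, the quotients of the $A_n$ converge to $S$) with $|\!|\!|A_n|\!|\!|_3=1$ for all $n$. Then there are a sequence $(A_n')\subset\mathcal Y$ and a sequence $(r_n)\subset L^3(\mathbb{R}^3,\mathbb{R}^3)$ such that, for all $n$, $\nabla\cdot(|A_n'|A_n')=0$ and $\|A_n'\|_3=1$,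 such that $$\nabla\wedge A_n'-\nabla\wedge A_n\to0\quad\text{in }L^{3/2}(\mathbb{R}^3,\mathbb{R}^3),\qquad r_n\to0\quad\text{in }L^3(\mathbb{R}^3,\mathbb{R}^3),$$ and such that, for all $n$, in the sense of distributions, $$\nabla\wedge\left(|\nabla\wedge A_n'|^{-1/2}\,\nabla\wedge A_n'\right)-S\,|A_n'|A_n'=\nabla\wedge r_n ,$$ where $|\nabla\wedge A_n'|^{-1/2}\,\nabla\wedge A_n'$ is understood as $0$ where $\nabla\wedge A_n'=0$. -/

import Mathlib

open MeasureTheory Filter Topology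
open scoped ContDiff ENNReal

noncomputable section

namespace CurlSobolev

/-- Three-dimensional Euclidean space. -/
abbrev E3 : Type := EuclideanSpace ℝ (Fin 3)

/-- The partial derivative `∂_i V_j` of a differentiable vector field. -/
def partialDeriv (i j : Fin 3) (V : E3 → E3) (x : E3) : ℝ :=
  (fderiv ℝ V x (EuclideanSpace.single i 1)) j

/-- The classical curl of a differentiable vector field. -/
def curl (V : E3 → E3) (x : E3) : E3 :=
  !₂[partialDeriv 1 2 V x - partialDeriv 2 1 V x,
     partialDeriv 2 0 V x - partialDeriv 0 2 V x,
     partialDeriv 0 1 V x - partialDeriv 1 0 V x]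

/-- Test functions: smooth and compactly supported, scalar- or vector-valued. -/
def IsTest {F : Type*} [NormedAddCommGroup F] [NormedSpace ℝ F] (φ : E3 → F) : Prop :=
  ContDiff ℝ ∞ φ ∧ HasCompactSupport φ

/-- `∇ ∧ A = B` in the sense of distributions, for locally integrable `A` and `B`. -/
def HasWeakCurl (A B : E3 → E3) : Prop :=
  LocallyIntegrable A ∧ LocallyIntegrable B ∧
    ∀ Φ : E3 → E3, IsTest Φ → ∫ x, inner ℝ (A x) (curl Φ x) = ∫ x, inner ℝ (B x) (Φ x)

open Classical in
/-- The distributional curl of `A` when it is a locally integrable function (and `0` otherwise).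
It is determined up to equality almost everywhere, see `HasWeakCurl.ae_eq`. -/
def weakCurl (A : E3 → E3) : E3 → E3 :=
  if h : ∃ B, HasWeakCurl A B then h.choose else 0

/-- `∇φ = G` in the sense of distributions, for locally integrable `φ` and `G`. -/
def HasWeakGradient (φ : E3 → ℝ) (G : E3 → E3) : Prop :=
  LocallyIntegrable φ ∧ LocallyIntegrable G ∧
    ∀ η : E3 → ℝ, IsTest η → ∫ x, φ x • gradient η x = -∫ x, η x • G x

/-- `∇ · V = 0` in the sense of distributions, for locally integrable `V`. -/
def WeaklyDivFree (V : E3 → E3) : Prop :=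
  LocallyIntegrable V ∧ ∀ η : E3 → ℝ, IsTest η → ∫ x, inner ℝ (V x) (gradient η x) = 0

/-- The space `𝒴` of all `A ∈ L³(ℝ³, ℝ³)` with distributional curl in `L^{3/2}`. -/
def MemY (A : E3 → E3) : Prop :=
  MemLp A 3 ∧ ∃ B, MemLp B (3 / 2) ∧ HasWeakCurl A B

/-- The gauge-invariant seminorm `⦀A⦀₃ = inf_φ ‖A - ∇φ‖₃`, the infimum being over all
`φ ∈ L¹_loc` with distributional gradient in `L³`. -/
def gaugeSeminorm (A : E3 → E3) : ℝ :=
  sInf {r : ℝ | ∃ (φ : E3 → ℝ) (G : E3 → E3),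
    HasWeakGradient φ G ∧ MemLp G 3 ∧ r = lpNorm (A - G) 3 volume}

/-- The quotient `‖∇ ∧ A‖_{3/2}^{3/2} / ⦀A⦀₃^{3/2}`. -/
def sobolevQuotient (A : E3 → E3) : ℝ :=
  lpNorm (weakCurl A) (3 / 2) volume ^ (3 / 2 : ℝ) / gaugeSeminorm A ^ (3 / 2 : ℝ)

/-- The constant `S`: the infimum of the quotient over all `A ∈ 𝒴` for which it makes sense. -/
def sobolevConst : ℝ :=
  sInf {q : ℝ | ∃ A : E3 → E3, MemY A ∧ gaugeSeminorm A ≠ 0 ∧ q = sobolevQuotient A}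

/-- `(A_n)` is a minimizing sequence for `S`. -/
def IsMinimizingSeq (A : ℕ → E3 → E3) : Prop :=
  (∀ n, MemY (A n) ∧ gaugeSeminorm (A n) ≠ 0) ∧
    Tendsto (fun n => sobolevQuotient (A n)) atTop (𝓝 sobolevConst)

theorem HasWeakCurl.weakCurl {A B : E3 → E3} (h : HasWeakCurl A B) :
    HasWeakCurl A (weakCurl A) := by
  have hex : ∃ B, HasWeakCurl A B := ⟨B, h⟩
  have := hex.choose_spec
  simpa [CurlSobolev.weakCurl, hex] using this

theorem HasWeakCurl.ae_eq {A B C : E3 → E3} (hB : HasWeakCurl A B) (hC : HasWeakCurl A C) :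
    B =ᵐ[volume] C := by
  have key : ∀ i : Fin 3, ∀ᵐ x, B x i = C x i := by
    intro i
    have hBi : LocallyIntegrable (fun x => B x i) := by
      intro x
      obtain ⟨s, hs, h⟩ := hB.2.1 x
      exact ⟨s, hs, (EuclideanSpace.proj (𝕜 := ℝ) i).integrable_comp h⟩
    have hCi : LocallyIntegrable (fun x => C x i) := by
      intro x
      obtain ⟨s, hs, h⟩ := hC.2.1 x
      exact ⟨s, hs, (EuclideanSpace.proj (𝕜 := ℝ) i).integrable_comp h⟩
    refine ae_eq_of_integral_contDiff_smul_eq hBi hCi fun g hg hgs => ?_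
    have hT : IsTest (fun x => g x • (EuclideanSpace.single i (1 : ℝ) : E3)) :=
      ⟨hg.smul contDiff_const, hgs.smul_right⟩
    have := (hB.2.2 _ hT).symm.trans (hC.2.2 _ hT)
    simpa [inner_smul_right, EuclideanSpace.inner_single_right] using this
  filter_upwards [ae_all_iff.2 key] with x hx
  ext i
  exact hx i

end CurlSobolev

end

/-! Let Γ be the graph of the weak curl in L³ × L^{3/2} and K the space of weak gradients in L³. Γ
is a closed subspace containing K × 0, and ⦀A⦀₃ is the distance from A to K. By definition of S, the
functional J(A, B) = ‖B‖^{3/2} - S dist(A, K)^{3/2} is nonnegative on Γ, and it tends to 0 along the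
minimizing sequence. Ekeland's principle (`ekeland_variational_principle`) therefore moves each pair
slightly to one where J is almost stationary.

Subtracting a nearest point of the closure of K leaves both B and the distance unchanged and yields
a representative v with ‖v‖ = dist(v, K). The first variation of its norm along K says that |v|v
annihilates gradients, which is the divergence condition. Since |v|v annihilates K, it also bounds
the distance from below along lines through v. With an upper expansion of ‖·‖^{3/2} this gives a
one-sided derivative of J, and linearity of Γ supplies both signs.

The derivative ℓ(A, B) = ⟨B, |b|^{-1/2} b⟩ - S κ ⟨|v|v, A⟩, where b is the curl of v and κ a
normalizing factor, is small compared with ‖B‖ alone: modulo K, ‖A‖ may be replaced by dist(A, K),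
which is at most a constant times ‖B‖ when S > 0. Hence ℓ factors through B with small norm
(Hahn-Banach), and the Riesz theorem for L^{3/2} represents it by a small r in L³. Taking A to be a
test field gives the equation. All this is `exists_almost_critical`; when S = 0 the equation holds
with r = |b|^{-1/2} b.

Nearest points in L³ come from Clarkson's inequality. The Riesz theorem is obtained by minimizing
(2/3)‖w‖^{3/2} - g w, using uniform convexity of the power 3/2. -/

noncomputable section

/-! ### Variational principles and Hahn-Banach -/

/-- An existence principle for minimizers: if almost minimizers are close to each other,
a continuous function that is bounded below on a complete space has a minimizer. -/
theorem exists_forall_le_of_almost_minimizers_close {X : Type*} [MetricSpace X] [CompleteSpace X]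
    [Nonempty X] {I : X → ℝ} (hc : Continuous I) (hb : BddBelow (Set.range I))
    (h : ∀ ε > 0, ∃ δ > 0, ∀ a b, I a ≤ (⨅ x, I x) + δ → I b ≤ (⨅ x, I x) + δ → dist a b ≤ ε) :
    ∃ x, ∀ y, I x ≤ I y := by
  set i := ⨅ x, I x with hi
  have hex : ∀ n : ℕ, ∃ x, I x < i + 1 / ((n : ℝ) + 1) := fun n =>
    exists_lt_of_ciInf_lt (lt_add_of_pos_right _ (by positivity))
  choose u hu using hex
  have hlim : Tendsto (fun n : ℕ => i + 1 / ((n : ℝ) + 1)) atTop (𝓝 i) := by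
    simpa using tendsto_one_div_add_atTop_nhds_zero_nat.const_add i
  have hcau : CauchySeq u := by
    refine Metric.cauchySeq_iff'.2 fun ε hε => ?_
    obtain ⟨δ, hδ, hd⟩ := h (ε / 2) (half_pos hε)
    obtain ⟨N, hN⟩ := (hlim.eventually (gt_mem_nhds (lt_add_of_pos_right i hδ))).exists_forall_of_atTop
    refine ⟨N, fun n hn => ?_⟩
    have := hd (u n) (u N) ((hu n).le.trans (hN n hn).le) ((hu N).le.trans (hN N le_rfl).le)
    linarith
  obtain ⟨x, hx⟩ := cauchySeq_tendsto_of_complete hcau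
  refine ⟨x, fun y => le_trans ?_ (ciInf_le hb y)⟩
  exact le_of_tendsto_of_tendsto' ((hc.tendsto x).comp hx) hlim fun n => (hu n).le

/-- **Ekeland's variational principle** for continuous functions that are bounded below by `0`. -/
theorem ekeland_variational_principle {X : Type*} [MetricSpace X] [CompleteSpace X]
    {J : X → ℝ} (hc : Continuous J) (h0 : ∀ x, 0 ≤ J x) {δ : ℝ} (hδ : 0 < δ) (x₀ : X) :
    ∃ x, J x + δ * dist x₀ x ≤ J x₀ ∧ ∀ y, J x ≤ J y + δ * dist x y := by
  -- `Q x` consists of the points whose decrease of `J` pays for their distance from `x`. These sets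
  -- are closed and nested along the iteration below, with diameters tending to 0.
  set Q : X → Set X := fun x => {y | J y + δ * dist x y ≤ J x} with hQ
  have hself : ∀ x, x ∈ Q x := fun x => by simp [hQ]
  have htrans : ∀ x y, y ∈ Q x → Q y ⊆ Q x := fun x y hy z hz => by
    simp only [hQ, Set.mem_ofPred_eq] at *
    nlinarith [dist_triangle x y z]
  have hclosed : ∀ x, IsClosed (Q x) := fun x => isClosed_le (by fun_prop) continuous_const
  have hex : ∀ (n : ℕ) (x : X), ∃ y ∈ Q x, ∀ z ∈ Q x, J y ≤ J z + 1 / ((n : ℝ) + 1) := by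
    intro n x
    have hbdd : BddBelow (J '' Q x) := ⟨0, by rintro _ ⟨y, -, rfl⟩; exact h0 y⟩
    obtain ⟨_, ⟨y, hy, rfl⟩, hlt⟩ := exists_lt_of_csInf_lt (⟨_, Set.mem_image_of_mem J (hself x)⟩)
      (lt_add_of_pos_right (sInf (J '' Q x)) (show (0 : ℝ) < 1 / ((n : ℝ) + 1) by positivity))
    exact ⟨y, hy, fun z hz => hlt.le.trans (by
      gcongr; exact csInf_le hbdd (Set.mem_image_of_mem J hz))⟩
  choose f hfQ hfle using hex
  set u : ℕ → X := fun n => Nat.rec x₀ (fun k x => f k x) n with hu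
  have husucc : ∀ n, u (n + 1) = f n (u n) := fun n => rfl
  have hnest : ∀ n m, n ≤ m → Q (u m) ⊆ Q (u n) := by
    intro n m hnm
    induction m, hnm using Nat.le_induction with
    | base => exact subset_rfl
    | succ m _ ih => exact (htrans _ _ (by rw [husucc]; exact hfQ _ _)).trans ih
  have hsmall : ∀ n, ∀ y ∈ Q (u (n + 1)), dist (u (n + 1)) y ≤ 1 / ((n : ℝ) + 1) / δ := by
    intro n y hy
    have h1 : J (u (n + 1)) ≤ J y + 1 / ((n : ℝ) + 1) :=
      hfle n (u n) y (hnest n (n + 1) n.le_succ hy)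
    have h2 : J y + δ * dist (u (n + 1)) y ≤ J (u (n + 1)) := hy
    rw [le_div_iff₀ hδ]
    linarith
  have hlim : Tendsto (fun n : ℕ => 1 / ((n : ℝ) + 1) / δ) atTop (𝓝 0) := by
    simpa using tendsto_one_div_add_atTop_nhds_zero_nat.div_const δ
  have hcau : CauchySeq u := by
    refine Metric.cauchySeq_iff'.2 fun ε hε => ?_
    obtain ⟨N, hN⟩ := (hlim.eventually (gt_mem_nhds hε)).exists
    refine ⟨N + 1, fun n hn => ?_⟩
    rw [dist_comm]
    exact (hsmall N (u n) (hnest _ _ hn (hself _))).trans_lt hN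
  obtain ⟨x, hx⟩ := cauchySeq_tendsto_of_complete hcau
  have hxQ : ∀ n, x ∈ Q (u n) := fun n =>
    (hclosed _).mem_of_tendsto hx (eventually_atTop.2 ⟨n, fun m hm => hnest n m hm (hself _)⟩)
  refine ⟨x, hxQ 0, fun y => ?_⟩
  -- A violating `y` would lie in `Q x`, hence in every `Q (u n)`; as these shrink to a point, `y =
  -- x`, and the strict inequality fails.
  by_contra! hy
  have hyQ : y ∈ Q x := hy.le
  have hlim' : Tendsto (fun n => u (n + 1)) atTop (𝓝 y) := by
    rw [tendsto_iff_dist_tendsto_zero]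
    exact squeeze_zero (fun _ => dist_nonneg)
      (fun n => hsmall n y (htrans _ _ (hxQ (n + 1)) hyQ)) hlim
  have : x = y := tendsto_nhds_unique (hx.comp (tendsto_add_atTop_nat 1)) hlim'
  subst this
  simp at hy

/-- **Hahn-Banach**: a linear functional on `X` dominated by `C * ‖T x‖` factors through `T`. -/
theorem exists_strongDual_comp_eq {X W : Type*} [AddCommGroup X] [Module ℝ X]
    [NormedAddCommGroup W] [NormedSpace ℝ W] (T : X →ₗ[ℝ] W) (ℓ : X →ₗ[ℝ] ℝ) {C : ℝ} (hC : 0 ≤ C)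
    (h : ∀ x, |ℓ x| ≤ C * ‖T x‖) : ∃ g : StrongDual ℝ W, ‖g‖ ≤ C ∧ ∀ x, g (T x) = ℓ x := by
  have hker : LinearMap.ker T ≤ LinearMap.ker ℓ := fun x hx => by
    have := h x
    rw [LinearMap.mem_ker.1 hx, norm_zero, mul_zero] at this
    simpa using this
  obtain ⟨f, hf⟩ : ∃ f : LinearMap.range T →ₗ[ℝ] ℝ, ∀ x, f ⟨T x, x, rfl⟩ = ℓ x := by
    refine ⟨(LinearMap.ker T).liftQ ℓ hker ∘ₗ T.quotKerEquivRange.symm.toLinearMap, fun x => ?_⟩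
    have : T.quotKerEquivRange.symm ⟨T x, x, rfl⟩ = Submodule.Quotient.mk x := by
      rw [LinearEquiv.symm_apply_eq]; rfl
    simp [this]
  have hbd : ∀ y, ‖f y‖ ≤ C * ‖y‖ := by
    rintro ⟨_, x, rfl⟩
    simpa [hf x] using h x
  obtain ⟨g, hg, hgn⟩ := _root_.exists_extension_norm_eq _ (f.mkContinuous C hbd)
  refine ⟨g, hgn.trans_le (f.mkContinuous_norm_le hC hbd), fun x => ?_⟩
  rw [← hf x]
  exact hg ⟨T x, x, rfl⟩

/-! ### Pointwise inequalities for powers of the norm -/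

section Pointwise

theorem abs_norm_add_sub_norm_le {E : Type*} [NormedAddCommGroup E] (a d : E) :
    |‖a + d‖ - ‖a‖| ≤ ‖d‖ := by
  simpa using abs_norm_sub_norm_le (a + d) a

variable {E : Type*} [NormedAddCommGroup E] [InnerProductSpace ℝ E]

/-- Second order upper bound for the third power of the norm. -/
theorem norm_add_pow_three_le (a d : E) :
    ‖a + d‖ ^ 3 ≤ ‖a‖ ^ 3 + 3 * (‖a‖ * inner ℝ a d) + 3 * (‖a‖ * ‖d‖ ^ 2) + ‖d‖ ^ 3 := by
  have h := norm_add_sq_real a d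
  have h1 := abs_norm_add_sub_norm_le a d
  set x := ‖a‖
  set y := ‖a + d‖
  set q := ‖d‖
  have hx : 0 ≤ x := norm_nonneg _
  have hy : 0 ≤ y := norm_nonneg _
  have hq : 0 ≤ q := norm_nonneg _
  have h2 : (y - x) ^ 2 ≤ q ^ 2 := sq_le_sq' (by linarith [abs_le.1 h1]) (abs_le.1 h1).2
  have h3 : y ≤ x + q := by linarith [(abs_le.1 h1).2]
  -- After the inner product is eliminated by polarization, the remainder is exactly (y - x)²(y +
  -- x/2) + (3/2) x q².
  have h4 : (y - x) ^ 2 * (y + x / 2) ≤ q ^ 2 * ((x + q) + x / 2) := by gcongr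
  have h5 : inner ℝ a d = (y ^ 2 - x ^ 2 - q ^ 2) / 2 := by linarith
  rw [h5]
  nlinarith

/-- Clarkson's inequality for the exponent `3`, pointwise version. -/
theorem norm_add_pow_three_add_norm_sub_pow_three_le (a b : E) :
    ‖a + b‖ ^ 3 + ‖a - b‖ ^ 3 ≤ 4 * (‖a‖ ^ 3 + ‖b‖ ^ 3) := by
  have h := parallelogram_law_with_norm ℝ a b
  set x := ‖a‖
  set y := ‖b‖
  set u := ‖a + b‖
  set v := ‖a - b‖
  have hx : 0 ≤ x := norm_nonneg _
  have hy : 0 ≤ y := norm_nonneg _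
  have hu : 0 ≤ u := norm_nonneg _
  have hv : 0 ≤ v := norm_nonneg _
  -- The ℓ³ norm on the plane is at most the ℓ² norm. The parallelogram law and the power mean
  -- inequality then give the claim.
  have h1 : (u ^ 3 + v ^ 3) ^ 2 ≤ (u ^ 2 + v ^ 2) ^ 3 := by
    have : 0 ≤ u ^ 2 * v ^ 2 * (2 * u ^ 2 + 2 * v ^ 2 + (u - v) ^ 2) := by positivity
    nlinarith
  have h2 : (u ^ 2 + v ^ 2) ^ 3 = 8 * (x ^ 2 + y ^ 2) ^ 3 := by
    rw [show u ^ 2 + v ^ 2 = 2 * (x ^ 2 + y ^ 2) by linarith]; ring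
  have h3 : 8 * (x ^ 2 + y ^ 2) ^ 3 ≤ (4 * (x ^ 3 + y ^ 3)) ^ 2 := by
    have : 0 ≤ (x - y) ^ 2 * (x ^ 4 + 2 * x ^ 3 * y + 2 * x * y ^ 3 + y ^ 4) := by positivity
    nlinarith
  exact (sq_le_sq₀ (by positivity) (by positivity)).1 (h1.trans (h2.trans_le h3))

/-- In terms of square roots of norms, the inequalities for the power 3/2 become polynomial. -/
theorem rpow_three_halves_eq (x : ℝ) (hx : 0 ≤ x) : x ^ (3 / 2 : ℝ) = √x ^ 3 := by
  rw [Real.sqrt_eq_rpow, ← Real.rpow_natCast, ← Real.rpow_mul hx]; norm_num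

theorem rpow_neg_half_eq (x : ℝ) (hx : 0 ≤ x) : x ^ (-(1 / 2) : ℝ) = (√x)⁻¹ := by
  rw [Real.rpow_neg hx, Real.sqrt_eq_rpow]

/-- Quantitative convexity of the power `3 / 2` of the norm. -/
theorem norm_rpow_three_halves_add_ge (u v : E) :
    ‖u‖ ^ (3 / 2 : ℝ) + 3 / 2 * inner ℝ (‖u‖ ^ (-(1 / 2) : ℝ) • u) v
      + ‖v‖ ^ 2 / (2 * (√‖u + v‖ + √‖u‖)) ≤ ‖u + v‖ ^ (3 / 2 : ℝ) := by
  have h := norm_add_sq_real u v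
  have h1 := abs_norm_add_sub_norm_le u v
  rw [inner_smul_left, conj_trivial, rpow_three_halves_eq _ (norm_nonneg _),
    rpow_three_halves_eq _ (norm_nonneg _), rpow_neg_half_eq _ (norm_nonneg _)]
  rcases eq_or_ne u 0 with rfl | hu
  · simp only [norm_zero, Real.sqrt_zero, zero_add, inner_zero_left, mul_zero, add_zero]
    have hq : ‖v‖ = √‖v‖ ^ 2 := (Real.sq_sqrt (norm_nonneg _)).symm
    have := Real.sqrt_nonneg ‖v‖
    set η := √‖v‖
    rw [hq]
    rcases eq_or_ne η 0 with h0 | h0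
    · simp [h0]
    · have : 0 < η := lt_of_le_of_ne this (Ne.symm h0)
      rw [zero_pow (by norm_num), zero_add, div_le_iff₀ (by positivity)]
      nlinarith [pow_pos this 4]
  set ξ := √‖u‖ with hξ
  set η := √‖u + v‖
  set q := ‖v‖
  have hξ0 : 0 < ξ := Real.sqrt_pos.2 (norm_pos_iff.2 hu)
  have hη0 : 0 ≤ η := Real.sqrt_nonneg _
  have e1 : ‖u‖ = ξ ^ 2 := (Real.sq_sqrt (norm_nonneg _)).symm
  have e2 : ‖u + v‖ = η ^ 2 := (Real.sq_sqrt (norm_nonneg _)).symm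
  rw [e1, e2] at h h1
  have h5 : inner ℝ u v = (η ^ 4 - ξ ^ 4 - q ^ 2) / 2 := by linarith
  have h2 : ((η - ξ) * (η + ξ)) ^ 2 ≤ q ^ 2 :=
    sq_le_sq' (by linarith [(abs_le.1 h1).1]) (by linarith [(abs_le.1 h1).2])
  rw [h5]
  -- Multiplied by 4ξ, the claim rests on 3η⁴ - 4η³ξ + ξ⁴ = (η - ξ)²(3η² + 2ηξ + ξ²), which must
  -- stay below 3q² by a margin; |η² - ξ²| ≤ q supplies it.
  have h6 : (η - ξ) ^ 2 ≤ q ^ 2 / (η + ξ) ^ 2 := by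
    rw [le_div_iff₀ (by positivity)]; linarith
  have h7 : (η - ξ) ^ 2 * (3 * η ^ 2 + 2 * η * ξ + ξ ^ 2)
      ≤ q ^ 2 / (η + ξ) ^ 2 * (3 * η ^ 2 + 2 * η * ξ + ξ ^ 2) := by gcongr
  have h8 : q ^ 2 / (η + ξ) ^ 2 * (3 * η ^ 2 + 2 * η * ξ + ξ ^ 2)
      = 3 * q ^ 2 - q ^ 2 / (η + ξ) ^ 2 * (4 * η * ξ + 2 * ξ ^ 2) := by
    field_simp; ring
  have h9 : q ^ 2 / (2 * (η + ξ)) * (4 * ξ) ≤ q ^ 2 / (η + ξ) ^ 2 * (4 * η * ξ + 2 * ξ ^ 2) := by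
    have : q ^ 2 / (2 * (η + ξ)) * (4 * ξ) = q ^ 2 / (η + ξ) ^ 2 * (2 * ξ * η + 2 * ξ ^ 2) := by
      field_simp; ring
    rw [this]
    have : 0 ≤ η * ξ := by positivity
    gcongr ?_ * ?_
    linarith
  have h10 : 3 / 2 * (ξ⁻¹ * ((η ^ 4 - ξ ^ 4 - q ^ 2) / 2)) * (4 * ξ)
      = 3 * (η ^ 4 - ξ ^ 4 - q ^ 2) := by field_simp; ring
  have h11 : (ξ ^ 3 + 3 / 2 * (ξ⁻¹ * ((η ^ 4 - ξ ^ 4 - q ^ 2) / 2)) + q ^ 2 / (2 * (η + ξ)))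
      * (4 * ξ) ≤ η ^ 3 * (4 * ξ) := by
    rw [add_mul, add_mul, h10]
    nlinarith
  exact le_of_mul_le_mul_right h11 (by positivity)

/-- Upper bound for the power `3 / 2` of the norm with the optimal power of the remainder. -/
theorem norm_add_rpow_three_halves_le (u v : E) :
    ‖u + v‖ ^ (3 / 2 : ℝ) ≤ ‖u‖ ^ (3 / 2 : ℝ) + 3 / 2 * inner ℝ (‖u‖ ^ (-(1 / 2) : ℝ) • u) v
      + 5 * ‖v‖ ^ (3 / 2 : ℝ) := by
  have h := norm_add_sq_real u v
  have h1 := abs_norm_add_sub_norm_le u v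
  rw [inner_smul_left, conj_trivial, rpow_three_halves_eq _ (norm_nonneg _),
    rpow_three_halves_eq _ (norm_nonneg _), rpow_three_halves_eq _ (norm_nonneg _),
    rpow_neg_half_eq _ (norm_nonneg _)]
  rcases eq_or_ne u 0 with rfl | hu
  · have := Real.sqrt_nonneg ‖v‖
    simp only [zero_add, norm_zero, Real.sqrt_zero, inner_zero_left, mul_zero, add_zero]
    nlinarith [pow_nonneg this 3]
  set ξ := √‖u‖ with hξ
  set η := √‖u + v‖
  set θ := √‖v‖
  have hξ0 : 0 < ξ := Real.sqrt_pos.2 (norm_pos_iff.2 hu)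
  have hη0 : 0 ≤ η := Real.sqrt_nonneg _
  have hθ0 : 0 ≤ θ := Real.sqrt_nonneg _
  have e1 : ‖u‖ = ξ ^ 2 := (Real.sq_sqrt (norm_nonneg _)).symm
  have e2 : ‖u + v‖ = η ^ 2 := (Real.sq_sqrt (norm_nonneg _)).symm
  have e3 : ‖v‖ = θ ^ 2 := (Real.sq_sqrt (norm_nonneg _)).symm
  rw [e1, e2, e3] at h
  rw [e1, e2, e3] at h1
  have h5 : inner ℝ u v = (η ^ 4 - ξ ^ 4 - θ ^ 4) / 2 := by linarith
  rw [h5]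
  have h10 : 3 / 2 * (ξ⁻¹ * ((η ^ 4 - ξ ^ 4 - θ ^ 4) / 2)) * (4 * ξ)
      = 3 * (η ^ 4 - ξ ^ 4 - θ ^ 4) := by field_simp; ring
  have h3 : η ^ 2 ≤ ξ ^ 2 + θ ^ 2 := by linarith [(abs_le.1 h1).2]
  have h4 : ξ ^ 2 ≤ η ^ 2 + θ ^ 2 := by linarith [(abs_le.1 h1).1]
  -- If θ ≤ ξ, the same factorization leaves only 3θ⁴ ≤ 3θ³ξ to absorb. If ξ ≤ θ, then η ≤ (3/2)θ
  -- and Cauchy-Schwarz bound the loss by (27/2 + 6) θ³ξ, which is less than 20 θ³ξ; hence the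
  -- constant 5.
  have key : η ^ 3 * (4 * ξ) ≤ ξ ^ 3 * (4 * ξ) + 3 * (η ^ 4 - ξ ^ 4 - θ ^ 4)
      + 5 * θ ^ 3 * (4 * ξ) := by
    have h0 : 0 ≤ (η - ξ) ^ 2 * (3 * η ^ 2 + 2 * η * ξ + ξ ^ 2) := by positivity
    rcases le_total θ ξ with hc | hc
    · have : θ ^ 3 * θ ≤ θ ^ 3 * ξ := by gcongr
      have : 0 ≤ θ ^ 3 * ξ := by positivity
      nlinarith
    · have hη : η ≤ 3 / 2 * θ := by
        refine (sq_le_sq₀ hη0 (by positivity)).1 ?_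
        nlinarith
      have hη3 : η ^ 3 * ξ ≤ (3 / 2 * θ) ^ 3 * ξ := by gcongr
      have hc2 : ξ * (ξ * θ ^ 2) ≤ θ * (ξ * θ ^ 2) := by gcongr
      have hin : -(ξ ^ 2 * θ ^ 2) ≤ (η ^ 4 - ξ ^ 4 - θ ^ 4) / 2 := by
        rw [← h5, ← e1, ← e3]
        exact (abs_le.1 (abs_real_inner_le_norm u v)).1
      have : 0 ≤ ξ ^ 4 := by positivity
      have : 0 ≤ θ ^ 3 * ξ := by positivity
      linarith
  have h11 : η ^ 3 * (4 * ξ) ≤ (ξ ^ 3 + 3 / 2 * (ξ⁻¹ * ((η ^ 4 - ξ ^ 4 - θ ^ 4) / 2))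
      + 5 * θ ^ 3) * (4 * ξ) := by
    rw [add_mul, add_mul, h10]
    exact key
  exact le_of_mul_le_mul_right h11 (by positivity)

end Pointwise

/-! ### The pairing of L^{3/2} with L³ and the duality maps -/

section LpDuality

instance fact_one_le_three_halves : Fact ((1 : ℝ≥0∞) ≤ 3 / 2) :=
  ⟨by rw [ENNReal.le_div_iff_mul_le (by simp) (by simp)]; norm_num⟩

instance fact_one_le_three : Fact ((1 : ℝ≥0∞) ≤ 3) := ⟨by norm_num⟩

theorem toReal_three_halves : (3 / 2 : ℝ≥0∞).toReal = 3 / 2 := by simp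

theorem three_halves_ne_top : (3 / 2 : ℝ≥0∞) ≠ ⊤ := ENNReal.div_ne_top (by simp) (by simp)

theorem three_halves_ne_zero : (3 / 2 : ℝ≥0∞) ≠ 0 := by simp

instance holderConjugate_three_halves_three : ENNReal.HolderConjugate (3 / 2) 3 where
  inv_add_inv_eq_inv := by
    rw [ENNReal.inv_div (by simp) (by simp), inv_one, ENNReal.div_eq_inv_mul, ← mul_add_one,
      two_add_one_eq_three]
    exact ENNReal.inv_mul_cancel (by simp) (by simp)

variable {α E : Type*} [MeasurableSpace α] {μ : Measure α} [NormedAddCommGroup E]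

theorem norm_rpow_eq_integral {p : ℝ≥0∞} [Fact (1 ≤ p)] (hp : p ≠ ⊤) (f : Lp E p μ) :
    ‖f‖ ^ p.toReal = ∫ x, ‖f x‖ ^ p.toReal ∂μ := by
  have hp0 : p ≠ 0 := (zero_lt_one.trans_le (Fact.out : 1 ≤ p)).ne'
  have h : 0 < p.toReal := ENNReal.toReal_pos hp0 hp
  rw [Lp.norm_def, (Lp.memLp f).eLpNorm_eq_integral_rpow_norm hp0 hp,
    ENNReal.toReal_ofReal (by positivity), ← Real.rpow_mul (by positivity),
    inv_mul_cancel₀ h.ne', Real.rpow_one]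

theorem norm_pow_three_eq_integral (f : Lp E 3 μ) : ‖f‖ ^ 3 = ∫ x, ‖f x‖ ^ 3 ∂μ := by
  have := norm_rpow_eq_integral (by simp) f
  norm_num at this
  simpa only [Real.rpow_ofNat] using this

theorem norm_rpow_three_halves_eq_integral (f : Lp E (3 / 2) μ) :
    ‖f‖ ^ (3 / 2 : ℝ) = ∫ x, ‖f x‖ ^ (3 / 2 : ℝ) ∂μ := by
  simpa only [toReal_three_halves] using norm_rpow_eq_integral three_halves_ne_top f

theorem integrable_norm_pow_three (f : Lp E 3 μ) : Integrable (fun x => ‖f x‖ ^ 3) μ := by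
  have := (Lp.memLp f).integrable_norm_rpow (by simp) (by simp)
  norm_num at this
  simpa only [Real.rpow_ofNat] using this

theorem integrable_norm_rpow_three_halves (f : Lp E (3 / 2) μ) :
    Integrable (fun x => ‖f x‖ ^ (3 / 2 : ℝ)) μ := by
  simpa only [toReal_three_halves] using
    (Lp.memLp f).integrable_norm_rpow three_halves_ne_zero three_halves_ne_top

variable [InnerProductSpace ℝ E]

/-- The pairing between `L^{3/2}` and `L³`. -/
def lpInner (w : Lp E (3 / 2) μ) (v : Lp E 3 μ) : ℝ := ∫ x, inner ℝ (w x) (v x) ∂μ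

theorem integrable_lpInner (w : Lp E (3 / 2) μ) (v : Lp E 3 μ) :
    Integrable (fun x => inner ℝ (w x) (v x)) μ :=
  memLp_one_iff_integrable.1
    ((innerSL ℝ).memLp_of_bilin (p := 3 / 2) (q := 3) 1 (Lp.memLp w) (Lp.memLp v))

theorem lpInner_eq_lpPairing (w : Lp E (3 / 2) μ) (v : Lp E 3 μ) :
    lpInner w v = (innerSL ℝ).lpPairing μ (3 / 2) 3 w v :=
  ((innerSL ℝ).lpPairing_eq_integral w v).symm

theorem lpInner_add_left (w w' : Lp E (3 / 2) μ) (v : Lp E 3 μ) :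
    lpInner (w + w') v = lpInner w v + lpInner w' v := by simp [lpInner_eq_lpPairing]

theorem lpInner_smul_left (c : ℝ) (w : Lp E (3 / 2) μ) (v : Lp E 3 μ) :
    lpInner (c • w) v = c * lpInner w v := by simp [lpInner_eq_lpPairing]

theorem lpInner_add_right (w : Lp E (3 / 2) μ) (v v' : Lp E 3 μ) :
    lpInner w (v + v') = lpInner w v + lpInner w v' := by simp [lpInner_eq_lpPairing]

theorem lpInner_sub_right (w : Lp E (3 / 2) μ) (v v' : Lp E 3 μ) :
    lpInner w (v - v') = lpInner w v - lpInner w v' := by simp [lpInner_eq_lpPairing]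

theorem lpInner_smul_right (c : ℝ) (w : Lp E (3 / 2) μ) (v : Lp E 3 μ) :
    lpInner w (c • v) = c * lpInner w v := by simp [lpInner_eq_lpPairing]

theorem continuous_lpInner_right (w : Lp E (3 / 2) μ) : Continuous (lpInner (μ := μ) w) := by
  simp_rw [funext (lpInner_eq_lpPairing w)]
  exact ((innerSL ℝ).lpPairing μ (3 / 2) 3 w).continuous

theorem continuous_lpInner_left (v : Lp E 3 μ) : Continuous (fun w => lpInner (μ := μ) w v) := by
  simp_rw [lpInner_eq_lpPairing]
  fun_prop

/-- **Hölder's inequality** for the pairing. -/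
theorem abs_lpInner_le (w : Lp E (3 / 2) μ) (v : Lp E 3 μ) : |lpInner w v| ≤ ‖w‖ * ‖v‖ := by
  have h1 : |lpInner w v| ≤ ∫ x, ‖w x‖ * ‖v x‖ ∂μ := by
    refine (abs_integral_le_integral_abs).trans (integral_mono_of_nonneg
      (Eventually.of_forall fun _ => abs_nonneg _) ?_
      (Eventually.of_forall fun x => abs_real_inner_le_norm _ _))
    exact (Lp.memLp w).norm.integrable_mul (Lp.memLp v).norm
  have h2 := integral_mul_norm_le_Lp_mul_Lq (μ := μ) (f := w) (g := v) (p := 3 / 2) (q := 3)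
    (Real.holderConjugate_iff.2 (by norm_num))
    (by convert Lp.memLp w using 1; simp [ENNReal.ofReal_div_of_pos])
    (by convert Lp.memLp v using 1; simp)
  rw [← norm_rpow_three_halves_eq_integral] at h2
  simp_rw [Real.rpow_ofNat] at h2
  rw [← norm_pow_three_eq_integral, ← Real.rpow_mul (norm_nonneg _), ← Real.rpow_natCast,
    ← Real.rpow_mul (norm_nonneg _)] at h2
  norm_num at h2
  exact h1.trans h2

theorem norm_norm_smul_rpow (x : E) : ‖‖x‖ • x‖ ^ (3 / 2 : ℝ) = ‖x‖ ^ 3 := by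
  rw [norm_smul, norm_norm, ← sq, ← Real.rpow_natCast, ← Real.rpow_mul (norm_nonneg _),
    ← Real.rpow_natCast]
  norm_num

theorem norm_norm_rpow_smul_pow (x : E) :
    ‖‖x‖ ^ (-(1 / 2) : ℝ) • x‖ ^ 3 = ‖x‖ ^ (3 / 2 : ℝ) := by
  rw [norm_smul, Real.norm_of_nonneg (Real.rpow_nonneg (norm_nonneg _) _),
    rpow_neg_half_eq _ (norm_nonneg _), rpow_three_halves_eq _ (norm_nonneg _)]
  rcases eq_or_ne x 0 with rfl | hx
  · simp
  · have : 0 < √‖x‖ := Real.sqrt_pos.2 (norm_pos_iff.2 hx)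
    nth_rw 2 [← Real.sq_sqrt (norm_nonneg x)]
    field_simp

theorem inner_norm_rpow_smul_self (x : E) :
    inner ℝ (‖x‖ ^ (-(1 / 2) : ℝ) • x) x = ‖x‖ ^ (3 / 2 : ℝ) := by
  rw [inner_smul_left, conj_trivial, real_inner_self_eq_norm_sq,
    rpow_neg_half_eq _ (norm_nonneg _), rpow_three_halves_eq _ (norm_nonneg _)]
  rcases eq_or_ne x 0 with rfl | hx
  · simp
  · have : 0 < √‖x‖ := Real.sqrt_pos.2 (norm_pos_iff.2 hx)
    nth_rw 2 [← Real.sq_sqrt (norm_nonneg x)]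
    field_simp

theorem memLp_norm_smul {f : α → E} (hf : MemLp f 3 μ) :
    MemLp (fun x => ‖f x‖ • f x) (3 / 2) μ := by
  have hm : AEStronglyMeasurable (fun x => ‖f x‖ • f x) μ := hf.1.norm.smul hf.1
  refine (integrable_norm_rpow_iff hm three_halves_ne_zero three_halves_ne_top).1 ?_
  simp_rw [toReal_three_halves, norm_norm_smul_rpow]
  have := hf.integrable_norm_rpow (by simp) (by simp)
  norm_num at this
  simpa only [Real.rpow_ofNat] using this

theorem memLp_norm_rpow_smul {f : α → E} (hf : MemLp f (3 / 2) μ) :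
    MemLp (fun x => ‖f x‖ ^ (-(1 / 2) : ℝ) • f x) 3 μ := by
  have hm : AEStronglyMeasurable (fun x => ‖f x‖ ^ (-(1 / 2) : ℝ) • f x) μ :=
    (hf.1.norm.aemeasurable.pow_const _).aestronglyMeasurable.smul hf.1
  refine (integrable_norm_rpow_iff hm (by simp) (by simp)).1 ?_
  simp_rw [ENNReal.toReal_ofNat, Real.rpow_ofNat, norm_norm_rpow_smul_pow]
  have := hf.integrable_norm_rpow three_halves_ne_zero three_halves_ne_top
  simpa only [toReal_three_halves] using this

/-- The duality map `v ↦ |v| v` from `L³` to `L^{3/2}`. -/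
def dualL3 (v : Lp E 3 μ) : Lp E (3 / 2) μ := (memLp_norm_smul (Lp.memLp v)).toLp

/-- The duality map `w ↦ |w|^{-1/2} w` from `L^{3/2}` to `L³`. -/
def dualL32 (w : Lp E (3 / 2) μ) : Lp E 3 μ := (memLp_norm_rpow_smul (Lp.memLp w)).toLp

theorem coeFn_dualL3 (v : Lp E 3 μ) : dualL3 v =ᵐ[μ] fun x => ‖v x‖ • v x := MemLp.coeFn_toLp _

theorem coeFn_dualL32 (w : Lp E (3 / 2) μ) :
    dualL32 w =ᵐ[μ] fun x => ‖w x‖ ^ (-(1 / 2) : ℝ) • w x := MemLp.coeFn_toLp _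

theorem lpInner_dualL3_self (v : Lp E 3 μ) : lpInner (dualL3 v) v = ‖v‖ ^ 3 := by
  rw [norm_pow_three_eq_integral]
  refine integral_congr_ae ?_
  filter_upwards [coeFn_dualL3 v] with x hx
  rw [hx, inner_smul_left, real_inner_self_eq_norm_sq, conj_trivial]
  ring

theorem norm_dualL3 (v : Lp E 3 μ) : ‖dualL3 v‖ = ‖v‖ ^ 2 := by
  have h : ‖dualL3 v‖ ^ (3 / 2 : ℝ) = ‖v‖ ^ 3 := by
    rw [norm_pow_three_eq_integral, norm_rpow_three_halves_eq_integral]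
    refine integral_congr_ae ?_
    filter_upwards [coeFn_dualL3 v] with x hx
    rw [hx, norm_norm_smul_rpow]
  refine (Real.rpow_left_inj (norm_nonneg _) (by positivity)
    (show (3 / 2 : ℝ) ≠ 0 by norm_num)).1 ?_
  rw [h, ← Real.rpow_natCast, ← Real.rpow_natCast, ← Real.rpow_mul (norm_nonneg _)]
  norm_num

theorem lpInner_self_dualL32 (w : Lp E (3 / 2) μ) : lpInner w (dualL32 w) = ‖w‖ ^ (3 / 2 : ℝ) := by
  rw [norm_rpow_three_halves_eq_integral]
  refine integral_congr_ae ?_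
  filter_upwards [coeFn_dualL32 w] with x hx
  rw [hx, real_inner_comm, inner_norm_rpow_smul_self]

theorem norm_dualL32_pow_three (w : Lp E (3 / 2) μ) : ‖dualL32 w‖ ^ 3 = ‖w‖ ^ (3 / 2 : ℝ) := by
  rw [norm_pow_three_eq_integral, norm_rpow_three_halves_eq_integral]
  refine integral_congr_ae ?_
  filter_upwards [coeFn_dualL32 w] with x hx
  rw [hx, norm_norm_rpow_smul_pow]

/-- **Clarkson's inequality** in `L³`. -/
theorem norm_add_pow_three_add_norm_sub_pow_three_le_Lp (f g : Lp E 3 μ) :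
    ‖f + g‖ ^ 3 + ‖f - g‖ ^ 3 ≤ 4 * (‖f‖ ^ 3 + ‖g‖ ^ 3) := by
  simp_rw [norm_pow_three_eq_integral]
  rw [← integral_add (integrable_norm_pow_three _) (integrable_norm_pow_three _),
    ← integral_add (integrable_norm_pow_three _) (integrable_norm_pow_three _),
    ← integral_const_mul]
  refine integral_mono_ae ((integrable_norm_pow_three _).add (integrable_norm_pow_three _))
    (((integrable_norm_pow_three _).add (integrable_norm_pow_three _)).const_mul _) ?_
  filter_upwards [Lp.coeFn_add f g, Lp.coeFn_sub f g] with x h1 h2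
  simp only [h1, h2, Pi.add_apply, Pi.sub_apply]
  exact norm_add_pow_three_add_norm_sub_pow_three_le _ _

/-- Expansion of `‖a + s d‖³` in `L³`. -/
theorem norm_add_smul_pow_three_le (a d : Lp E 3 μ) {s : ℝ} (hs : |s| ≤ 1) :
    ‖a + s • d‖ ^ 3 ≤ ‖a‖ ^ 3 + 3 * s * lpInner (dualL3 a) d
      + s ^ 2 * (3 * ‖a‖ ^ 3 + 4 * ‖d‖ ^ 3) := by
  have h1 := integrable_norm_pow_three a
  have h2 := (integrable_lpInner (dualL3 a) d).const_mul (3 * s)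
  have h3 := ((h1.const_mul 3).add ((integrable_norm_pow_three d).const_mul 4)).const_mul (s ^ 2)
  have h12 : Integrable (fun x => ‖a x‖ ^ 3 + 3 * s * inner ℝ (dualL3 a x) (d x)) μ := h1.add h2
  simp only [Pi.add_apply] at h3
  have key : ∫ x, (‖a x‖ ^ 3 + 3 * s * inner ℝ (dualL3 a x) (d x))
      + s ^ 2 * (3 * ‖a x‖ ^ 3 + 4 * ‖d x‖ ^ 3) ∂μ
      = ‖a‖ ^ 3 + 3 * s * lpInner (dualL3 a) d + s ^ 2 * (3 * ‖a‖ ^ 3 + 4 * ‖d‖ ^ 3) := by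
    rw [integral_add h12 h3, integral_add h1 h2, integral_const_mul, integral_const_mul,
      integral_add (h1.const_mul 3) ((integrable_norm_pow_three d).const_mul 4),
      integral_const_mul, integral_const_mul, ← norm_pow_three_eq_integral,
      ← norm_pow_three_eq_integral, lpInner]
  rw [← key, norm_pow_three_eq_integral]
  refine integral_mono_ae (integrable_norm_pow_three _) (h12.add h3) ?_
  filter_upwards [Lp.coeFn_add a (s • d), Lp.coeFn_smul s d, coeFn_dualL3 a] with x e1 e2 e3
  simp only [e1, e2, e3, Pi.add_apply, Pi.smul_apply]
  refine (norm_add_pow_three_le _ _).trans ?_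
  rw [inner_smul_right, inner_smul_left, conj_trivial, norm_smul, Real.norm_eq_abs, mul_pow,
    mul_pow, sq_abs, pow_succ |s| 2, sq_abs]
  have hx := norm_nonneg (a x)
  have hq := norm_nonneg (d x)
  have h4 : s ^ 2 * |s| * ‖d x‖ ^ 3 ≤ s ^ 2 * 1 * ‖d x‖ ^ 3 := by gcongr
  -- Splitting the mixed term this way produces the coefficients 3 and 3 + 1 = 4.
  have h5 : ‖a x‖ * ‖d x‖ ^ 2 ≤ ‖a x‖ ^ 3 + ‖d x‖ ^ 3 := by
    rcases le_total ‖a x‖ ‖d x‖ with h | h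
    · nlinarith [mul_le_mul_of_nonneg_right h (sq_nonneg ‖d x‖), pow_nonneg hx 3]
    · nlinarith [mul_le_mul_of_nonneg_left (pow_le_pow_left₀ hq h 2) hx, pow_nonneg hq 3]
  have h6 : s ^ 2 * (‖a x‖ * ‖d x‖ ^ 2) ≤ s ^ 2 * (‖a x‖ ^ 3 + ‖d x‖ ^ 3) := by gcongr
  linarith

/-- With `s • v` in place of `v` the error is of order s√s, hence negligible against s: an upper
expansion whose linear term is given by `dualL32 u`. -/
theorem norm_add_rpow_three_halves_le_Lp (u v : Lp E (3 / 2) μ) :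
    ‖u + v‖ ^ (3 / 2 : ℝ) ≤ ‖u‖ ^ (3 / 2 : ℝ) + 3 / 2 * lpInner v (dualL32 u)
      + 5 * ‖v‖ ^ (3 / 2 : ℝ) := by
  have h1 := integrable_norm_rpow_three_halves u
  have h2 := (integrable_lpInner v (dualL32 u)).const_mul (3 / 2)
  have h3 := (integrable_norm_rpow_three_halves v).const_mul 5
  have h12 : Integrable (fun x => ‖u x‖ ^ (3 / 2 : ℝ) + 3 / 2 * inner ℝ (v x) (dualL32 u x)) μ :=
    h1.add h2
  simp_rw [norm_rpow_three_halves_eq_integral]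
  rw [lpInner, ← integral_const_mul, ← integral_const_mul, ← integral_add h1 h2,
    ← integral_add h12 h3]
  refine integral_mono_ae (integrable_norm_rpow_three_halves _) (h12.add h3) ?_
  filter_upwards [Lp.coeFn_add u v, coeFn_dualL32 u] with x h1 h2
  simp only [h1, h2, Pi.add_apply]
  rw [real_inner_comm]
  exact norm_add_rpow_three_halves_le _ _

end LpDuality

/-! ### Uniform convexity, nearest points and Riesz representation -/

section LpGeometry

/-- Uniform convexity of the power `3 / 2` of the norm, pointwise version. -/
theorem norm_rpow_three_halves_le_gap {E : Type*} [NormedAddCommGroup E] [InnerProductSpace ℝ E]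
    (u v : E) {τ : ℝ} (hτ : 0 < τ) :
    ‖v‖ ^ (3 / 2 : ℝ) ≤
      2 / τ * (‖u + v‖ ^ (3 / 2 : ℝ) + ‖u - v‖ ^ (3 / 2 : ℝ) - 2 * ‖u‖ ^ (3 / 2 : ℝ))
        + 4 * τ ^ 3 * (‖u + v‖ ^ (3 / 2 : ℝ) + ‖u - v‖ ^ (3 / 2 : ℝ)) := by
  have h1 := norm_rpow_three_halves_add_ge u v
  -- Adding the bounds for `v` and `-v` cancels the linear terms and leaves the convexity gap.
  have h2 := norm_rpow_three_halves_add_ge u (-v)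
  rw [inner_neg_right, norm_neg, ← sub_eq_add_neg] at h2
  have hu : ‖u‖ ≤ ‖u + v‖ + ‖u - v‖ := by
    have := norm_add_le (u + v) (u - v)
    rw [show u + v + (u - v) = (2 : ℝ) • u by rw [two_smul]; abel, norm_smul] at this
    norm_num at this
    linarith [norm_nonneg u]
  set a := u + v
  set b := u - v
  have hgap : ‖v‖ ^ 2 / (2 * (√‖a‖ + √‖u‖)) + ‖v‖ ^ 2 / (2 * (√‖b‖ + √‖u‖)) ≤
      ‖a‖ ^ (3 / 2 : ℝ) + ‖b‖ ^ (3 / 2 : ℝ) - 2 * ‖u‖ ^ (3 / 2 : ℝ) := by linarith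
  set D := ‖a‖ ^ (3 / 2 : ℝ) + ‖b‖ ^ (3 / 2 : ℝ) - 2 * ‖u‖ ^ (3 / 2 : ℝ)
  rw [rpow_three_halves_eq _ (norm_nonneg v), rpow_three_halves_eq _ (norm_nonneg a),
    rpow_three_halves_eq _ (norm_nonneg b)]
  have hv : ‖v‖ = √‖v‖ ^ 2 := (Real.sq_sqrt (norm_nonneg _)).symm
  have hua : √‖u‖ ≤ √‖a‖ + √‖b‖ := by
    refine Real.sqrt_le_iff.2 ⟨by positivity, ?_⟩
    nlinarith [Real.sq_sqrt (norm_nonneg a), Real.sq_sqrt (norm_nonneg b), Real.sqrt_nonneg ‖a‖,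
      Real.sqrt_nonneg ‖b‖, mul_nonneg (Real.sqrt_nonneg ‖a‖) (Real.sqrt_nonneg ‖b‖)]
  have hpos : ∀ c : E, ‖v‖ ≤ ‖c‖ + ‖u‖ → 0 < √‖v‖ → 0 < √‖c‖ + √‖u‖ := by
    intro c hc hv
    rcases (norm_nonneg c).eq_or_lt with h | h
    · rw [← h, zero_add] at hc
      have := Real.sqrt_pos.2 ((Real.sqrt_pos.1 hv).trans_le hc)
      positivity
    · have := Real.sqrt_pos.2 h
      positivity
  have hpa := hpos a (by simpa [a] using norm_sub_le (u + v) u)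
  have hpb := hpos b (by simpa [b, add_comm] using norm_sub_le u (u - v))
  have ha := Real.sqrt_nonneg ‖a‖
  have hb := Real.sqrt_nonneg ‖b‖
  have hu0 := Real.sqrt_nonneg ‖u‖
  have hθ := Real.sqrt_nonneg ‖v‖
  have hD : 0 ≤ D := le_trans (by positivity) hgap
  rw [hv] at hgap
  set x := √‖a‖
  set y := √‖b‖
  set ξ := √‖u‖
  set θ := √‖v‖
  have hσ : (x + y) ^ 3 ≤ 4 * (x ^ 3 + y ^ 3) := by
    nlinarith [mul_nonneg (add_nonneg ha hb) (sq_nonneg (x - y))]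
  rcases eq_or_lt_of_le hθ with h0 | h0
  · have : 0 ≤ 2 / τ * D := by positivity
    have : 0 ≤ 4 * τ ^ 3 * (x ^ 3 + y ^ 3) := by positivity
    rw [← h0, zero_pow (by norm_num)]
    linarith
  -- A small θ is covered by the τ³ term. Otherwise both denominators are controlled by θ/τ, because
  -- x + ξ and y + ξ are at most 2(x + y), and the gap dominates.
  rcases le_or_gt θ (τ * (x + y)) with hc | hc
  · have : θ ^ 3 ≤ (τ * (x + y)) ^ 3 := by gcongr
    rw [mul_pow] at this
    have h3 : τ ^ 3 * (x + y) ^ 3 ≤ τ ^ 3 * (4 * (x ^ 3 + y ^ 3)) := by gcongr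
    have : 0 ≤ 2 / τ * D := by positivity
    linarith
  · have hlow : ∀ z, 0 ≤ z → z ≤ x + y → 0 < z + ξ →
        θ ^ 3 * τ / 4 ≤ (θ ^ 2) ^ 2 / (2 * (z + ξ)) := by
      intro z hz hzs hpos
      rw [le_div_iff₀ (by positivity)]
      have : τ * (z + ξ) ≤ 2 * θ := by nlinarith
      nlinarith [mul_le_mul_of_nonneg_left this (pow_nonneg hθ 3)]
    have h4 := hlow x ha (by linarith) (hpa h0)
    have h5 := hlow y hb (by linarith) (hpb h0)
    have h6 : θ ^ 3 ≤ 2 / τ * D := by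
      rw [div_mul_eq_mul_div, le_div_iff₀ hτ]
      linarith
    have : 0 ≤ 4 * τ ^ 3 * (x ^ 3 + y ^ 3) := by positivity
    linarith

/-- This replaces differentiation: an inequality with error s√s is divided by s, and then s → 0⁺. -/
theorem nonpos_of_forall_le_mul_sqrt {c K : ℝ} (h : ∀ s : ℝ, 0 < s → s ≤ 1 → c ≤ K * √s) :
    c ≤ 0 := by
  have hlim : Tendsto (fun s : ℝ => K * √s) (𝓝[>] 0) (𝓝 (K * √0)) :=
    ((Real.continuous_sqrt.const_mul K).tendsto 0).mono_left nhdsWithin_le_nhds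
  rw [Real.sqrt_zero, mul_zero] at hlim
  refine ge_of_tendsto hlim ?_
  filter_upwards [Ioc_mem_nhdsGT (zero_lt_one (α := ℝ))] with s hs using h s hs.1 hs.2

variable {α E : Type*} [MeasurableSpace α] {μ : Measure α} [NormedAddCommGroup E]
  [InnerProductSpace ℝ E]

/-- The pointwise bound is linear in the 3/2 powers, so it integrates without Hölder. For bounded
families one fixes τ small first and then makes the gap small. -/
theorem norm_rpow_three_halves_le_gap_Lp (u v : Lp E (3 / 2) μ) {τ : ℝ} (hτ : 0 < τ) :
    ‖v‖ ^ (3 / 2 : ℝ) ≤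
      2 / τ * (‖u + v‖ ^ (3 / 2 : ℝ) + ‖u - v‖ ^ (3 / 2 : ℝ) - 2 * ‖u‖ ^ (3 / 2 : ℝ))
        + 4 * τ ^ 3 * (‖u + v‖ ^ (3 / 2 : ℝ) + ‖u - v‖ ^ (3 / 2 : ℝ)) := by
  simp_rw [norm_rpow_three_halves_eq_integral]
  have h1 := integrable_norm_rpow_three_halves (u + v)
  have h2 := integrable_norm_rpow_three_halves (u - v)
  have h3 := (integrable_norm_rpow_three_halves u).const_mul 2
  have h12 : Integrable (fun x => ‖(u + v) x‖ ^ (3 / 2 : ℝ) + ‖(u - v) x‖ ^ (3 / 2 : ℝ)) μ :=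
    h1.add h2
  have h4 : Integrable (fun x => 2 / τ * (‖(u + v) x‖ ^ (3 / 2 : ℝ) + ‖(u - v) x‖ ^ (3 / 2 : ℝ)
      - 2 * ‖u x‖ ^ (3 / 2 : ℝ))) μ := (h12.sub h3).const_mul _
  rw [← integral_add h1 h2, ← integral_const_mul 2, ← integral_sub h12 h3, ← integral_const_mul,
    ← integral_const_mul, ← integral_add h4 (h12.const_mul _)]
  refine integral_mono_ae (integrable_norm_rpow_three_halves _)
    (h4.add (h12.const_mul _)) ?_
  filter_upwards [Lp.coeFn_add u v, Lp.coeFn_sub u v] with x e1 e2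
  simp only [e1, e2, Pi.add_apply, Pi.sub_apply]
  exact norm_rpow_three_halves_le_gap _ _ hτ

/-- First variation at a point of a subspace of `L³` that is nearest to the origin modulo `K`. -/
theorem lpInner_dualL3_eq_zero {K : Submodule ℝ (Lp E 3 μ)} {v : Lp E 3 μ}
    (h : ∀ g ∈ K, ‖v‖ ≤ ‖v + g‖) {g : Lp E 3 μ} (hg : g ∈ K) : lpInner (dualL3 v) g = 0 := by
  have hle : ∀ g ∈ K, -lpInner (dualL3 v) g ≤ 0 := by
    intro g hg
    refine nonpos_of_forall_le_mul_sqrt (K := (3 * ‖v‖ ^ 3 + 4 * ‖g‖ ^ 3) / 3) fun s hs hs1 => ?_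
    have h1 := norm_add_smul_pow_three_le v g (s := s) (abs_le.2 ⟨by linarith, hs1⟩)
    have h2 := pow_le_pow_left₀ (norm_nonneg _) (h (s • g) (K.smul_mem s hg)) 3
    set C := 3 * ‖v‖ ^ 3 + 4 * ‖g‖ ^ 3
    have hC : 0 ≤ C := by positivity
    have h3 : s ≤ √s := Real.le_sqrt_of_sq_le (by nlinarith)
    have h4 : -lpInner (dualL3 v) g ≤ C / 3 * s := by
      refine le_of_mul_le_mul_left ?_ hs
      linarith
    exact h4.trans (by gcongr)
  have h1 := hle g hg
  have h2 := hle _ (K.smul_mem (-1 : ℝ) hg)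
  rw [lpInner_smul_right] at h2
  linarith

variable [CompleteSpace E]

/-- The functional `w ↦ (2/3) ‖w‖^{3/2} - g w` on `L^{3/2}` has a minimizer. -/
theorem exists_minimizer_two_thirds_norm_rpow_sub (g : StrongDual ℝ (Lp E (3 / 2) μ)) :
    ∃ w, ∀ y, 2 / 3 * ‖w‖ ^ (3 / 2 : ℝ) - g w ≤ 2 / 3 * ‖y‖ ^ (3 / 2 : ℝ) - g y := by
  set G := ‖g‖
  have hG : 0 ≤ G := norm_nonneg g
  set I : Lp E (3 / 2) μ → ℝ := fun w => 2 / 3 * ‖w‖ ^ (3 / 2 : ℝ) - g w with hI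
  -- Coercivity: the linear term is absorbed by splitting at √‖w‖ = 3G.
  have hlow : ∀ w, 1 / 3 * ‖w‖ ^ (3 / 2 : ℝ) - 9 * G ^ 3 ≤ I w := by
    intro w
    have h1 : g w ≤ G * ‖w‖ := (le_abs_self _).trans (g.le_opNorm w)
    have hx := Real.sqrt_nonneg ‖w‖
    simp only [hI]
    rw [rpow_three_halves_eq _ (norm_nonneg _)]
    have e : ‖w‖ = √‖w‖ ^ 2 := (Real.sq_sqrt (norm_nonneg _)).symm
    have h2 : G * √‖w‖ ^ 2 ≤ 1 / 3 * √‖w‖ ^ 3 + 9 * G ^ 3 := by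
      rcases le_total √‖w‖ (3 * G) with h | h
      · have := mul_le_mul_of_nonneg_left (pow_le_pow_left₀ hx h 2) hG
        have := pow_nonneg hx 3
        linarith
      · have := mul_le_mul_of_nonneg_right h (sq_nonneg √‖w‖)
        have := pow_nonneg hG 3
        linarith
    rw [← e] at h2
    linarith
  have hb : BddBelow (Set.range I) := by
    refine ⟨-(9 * G ^ 3), ?_⟩
    rintro _ ⟨w, rfl⟩
    have : 0 ≤ ‖w‖ ^ (3 / 2 : ℝ) := by positivity
    linarith [hlow w]
  have hc : Continuous I :=
    ((continuous_norm.rpow_const fun _ => Or.inr (by norm_num)).const_mul _).sub g.continuous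
  refine exists_forall_le_of_almost_minimizers_close hc hb fun ε hε => ?_
  have hi0 : (⨅ x, I x) ≤ 0 := (ciInf_le hb 0).trans (by simp [hI])
  set R := 3 * (1 + 9 * G ^ 3)
  have hR : 0 < R := by positivity
  set η := (ε / 2) ^ (3 / 2 : ℝ) with hη
  have hη0 : 0 < η := by positivity
  -- `R` bounds ‖·‖^{3/2} on almost minimizers. Then τ brings the τ³ term below η/2, and δ ≤ τη/12
  -- does the same for the gap term, the gap being at most 3δ by comparison with the midpoint.
  set τ := min 1 (η / (16 * R))
  have hτ : 0 < τ := by positivity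
  refine ⟨min 1 (τ * η / 12), by positivity, fun a b ha hb' => ?_⟩
  set δ := min 1 (τ * η / 12)
  have hδ1 : δ ≤ 1 := min_le_left _ _
  have hδ2 : δ ≤ τ * η / 12 := min_le_right _ _
  have hRa : ∀ c, I c ≤ (⨅ x, I x) + δ → ‖c‖ ^ (3 / 2 : ℝ) ≤ R := fun c hc => by
    linarith [hlow c]
  set u := (1 / 2 : ℝ) • (a + b) with hu
  set v := (1 / 2 : ℝ) • (a - b) with hv
  have e1 : u + v = a := by rw [hu, hv]; module
  have e2 : u - v = b := by rw [hu, hv]; module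
  have hgap := norm_rpow_three_halves_le_gap_Lp u v hτ
  rw [e1, e2] at hgap
  have hgu : g u = (g a + g b) / 2 := by simp [hu]; ring
  have hIu : (⨅ x, I x) ≤ 2 / 3 * ‖u‖ ^ (3 / 2 : ℝ) - (g a + g b) / 2 := hgu ▸ ciInf_le hb u
  have hD : ‖a‖ ^ (3 / 2 : ℝ) + ‖b‖ ^ (3 / 2 : ℝ) - 2 * ‖u‖ ^ (3 / 2 : ℝ) ≤ 3 * δ := by
    simp only [hI] at ha hb' hIu ⊢
    linarith
  have h1 : 2 / τ * (‖a‖ ^ (3 / 2 : ℝ) + ‖b‖ ^ (3 / 2 : ℝ) - 2 * ‖u‖ ^ (3 / 2 : ℝ)) ≤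
      2 / τ * (3 * (τ * η / 12)) := by gcongr; linarith
  have h2 : 2 / τ * (3 * (τ * η / 12)) = η / 2 := by field_simp; norm_num
  have h3 : 4 * τ ^ 3 * (‖a‖ ^ (3 / 2 : ℝ) + ‖b‖ ^ (3 / 2 : ℝ)) ≤ η / 2 := by
    have hτ3 : τ ^ 3 ≤ η / (16 * R) :=
      (pow_le_of_le_one hτ.le (min_le_left _ _) (by norm_num)).trans (min_le_right _ _)
    calc _ ≤ 4 * (η / (16 * R)) * (R + R) := by
          gcongr
          exacts [hRa a ha, hRa b hb']
      _ = η / 2 := by field_simp; norm_num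
  have h4 : ‖v‖ ^ (3 / 2 : ℝ) ≤ (ε / 2) ^ (3 / 2 : ℝ) := by linarith
  have h5 : ‖v‖ ≤ ε / 2 := (Real.rpow_le_rpow_iff (norm_nonneg _) (by positivity)
    (by norm_num)).1 h4
  rw [hv, norm_smul] at h5
  norm_num at h5
  rw [dist_eq_norm]
  linarith

/-- **Riesz representation**: the dual of `L^{3/2}` is `L³`. -/
theorem exists_forall_eq_lpInner (g : StrongDual ℝ (Lp E (3 / 2) μ)) :
    ∃ r : Lp E 3 μ, ‖r‖ ≤ ‖g‖ ∧ ∀ f, g f = lpInner f r := by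
  obtain ⟨w, hw⟩ := exists_minimizer_two_thirds_norm_rpow_sub g
  -- Euler-Lagrange inequality at the minimizer; the factor 2/3 cancels the exponent 3/2.
  have hle : ∀ k, g k - lpInner k (dualL32 w) ≤ 0 := by
    intro k
    refine nonpos_of_forall_le_mul_sqrt (K := 10 / 3 * ‖k‖ ^ (3 / 2 : ℝ)) fun s hs _ => ?_
    have h1 := hw (w + s • k)
    have h2 := norm_add_rpow_three_halves_le_Lp w (s • k)
    rw [lpInner_smul_left, norm_smul, Real.norm_of_nonneg hs.le,
      Real.mul_rpow hs.le (norm_nonneg _), rpow_three_halves_eq s hs.le] at h2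
    rw [map_add, map_smul, smul_eq_mul] at h1
    have hss : √s ^ 3 = s * √s := by rw [pow_succ, Real.sq_sqrt hs.le]
    rw [hss] at h2
    refine le_of_mul_le_mul_left ?_ hs
    linarith
  have heq : ∀ k, g k = lpInner k (dualL32 w) := by
    intro k
    have h1 := hle k
    have h2 := hle ((-1 : ℝ) • k)
    rw [map_smul, lpInner_smul_left, smul_eq_mul] at h2
    linarith
  refine ⟨dualL32 w, ?_, heq⟩
  have h1 := norm_dualL32_pow_three w
  have h2 : g w = ‖w‖ ^ (3 / 2 : ℝ) := by rw [heq, lpInner_self_dualL32]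
  have h3 : g w ≤ ‖g‖ * ‖w‖ := (le_abs_self _).trans (g.le_opNorm w)
  rw [h2] at h3
  rw [rpow_three_halves_eq _ (norm_nonneg _)] at h1 h3
  have h4 : ‖dualL32 w‖ = √‖w‖ :=
    (pow_left_inj₀ (norm_nonneg _) (Real.sqrt_nonneg _) (by norm_num)).1 h1
  rw [h4]
  rcases eq_or_lt_of_le (Real.sqrt_nonneg ‖w‖) with h | h
  · rw [← h]; exact norm_nonneg g
  · have e : ‖w‖ = √‖w‖ ^ 2 := (Real.sq_sqrt (norm_nonneg _)).symm
    refine le_of_mul_le_mul_right (a := √‖w‖ ^ 2) ?_ (by positivity)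
    rw [← e]
    exact (show √‖w‖ * ‖w‖ = √‖w‖ ^ 3 by rw [pow_succ, ← e, mul_comm]).trans_le h3

/-- Nearest points in the closure of a subspace of `L³` exist. -/
theorem exists_mem_closure_norm_sub_eq_infDist (K : Submodule ℝ (Lp E 3 μ)) (a : Lp E 3 μ) :
    ∃ g ∈ K.topologicalClosure, ‖a - g‖ = Metric.infDist a K := by
  have : CompleteSpace K.topologicalClosure := K.isClosed_topologicalClosure.completeSpace_coe
  set I : K.topologicalClosure → ℝ := fun g => ‖a - g‖ ^ 3 with hI
  have hb : BddBelow (Set.range I) := ⟨0, by rintro _ ⟨g, rfl⟩; simp only [hI]; positivity⟩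
  obtain ⟨g, hg⟩ : ∃ g, ∀ y, I g ≤ I y := by
    refine exists_forall_le_of_almost_minimizers_close (by fun_prop) hb fun ε hε => ?_
    -- Clarkson applied to `a - x` and `a - y`, with the midpoint as competitor, gives ‖x - y‖³ ≤
    -- 8δ.
    refine ⟨ε ^ 3 / 8, by positivity, fun x y hx hy => ?_⟩
    have h1 := norm_add_pow_three_add_norm_sub_pow_three_le_Lp (a - x : Lp E 3 μ) (a - y)
    have h2 := ciInf_le hb ((1 / 2 : ℝ) • (x + y))
    have e1 : (a - x + (a - y) : Lp E 3 μ) = (2 : ℝ) • (a - (1 / 2 : ℝ) • (x + y)) := by module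
    have e2 : (a - x - (a - y) : Lp E 3 μ) = -(x - y) := by abel
    rw [e1, e2, norm_neg, norm_smul, mul_pow] at h1
    norm_num at h1
    simp only [hI] at hx hy h2
    norm_num at h2
    rw [Subtype.dist_eq, dist_eq_norm]
    refine (pow_le_pow_iff_left₀ (norm_nonneg _) hε.le (by norm_num : (3 : ℕ) ≠ 0)).1 ?_
    linarith
  refine ⟨g, g.2, le_antisymm ?_ ?_⟩
  · refine (Metric.le_infDist ⟨0, K.zero_mem⟩).2 fun y hy => ?_
    rw [dist_eq_norm]
    exact (pow_le_pow_iff_left₀ (norm_nonneg _) (norm_nonneg _) (by norm_num : (3 : ℕ) ≠ 0)).1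
      (hg ⟨y, K.le_topologicalClosure hy⟩)
  · rw [← Metric.infDist_closure, ← dist_eq_norm]
    exact Metric.infDist_le_dist_of_mem g.2

end LpGeometry

/-! ### Almost critical points from Ekeland's principle -/

section AlmostCritical

theorem infDist_add_mem {V : Type*} [SeminormedAddCommGroup V] [Module ℝ V] {K : Submodule ℝ V}
    {g : V} (hg : g ∈ K) (a : V) : Metric.infDist (a + g) K = Metric.infDist a K := by
  have hle : ∀ (a g : V), g ∈ K → Metric.infDist (a + g) K ≤ Metric.infDist a K := by
    intro a g hg
    refine (Metric.le_infDist ⟨0, K.zero_mem⟩).2 fun y hy => ?_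
    rw [← dist_add_right a y g]
    exact Metric.infDist_le_dist_of_mem (K.add_mem hy hg)
  refine le_antisymm (hle a g hg) ?_
  simpa using hle (a + g) (-g) (K.neg_mem hg)

/-- Convexity of t ↦ t^{3/2}, used to pass from a linear lower bound on the distance to one on its
power. In square roots the difference is (X - T)²(X + T/2). -/
theorem tangent_le_rpow_three_halves {x t : ℝ} (hx : 0 ≤ x) (ht : 0 ≤ t) :
    t ^ (3 / 2 : ℝ) + 3 / 2 * √t * (x - t) ≤ x ^ (3 / 2 : ℝ) := by
  rw [rpow_three_halves_eq _ hx, rpow_three_halves_eq _ ht]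
  obtain ⟨hX, hT⟩ := And.intro (Real.sqrt_nonneg x) (Real.sqrt_nonneg t)
  have ex := Real.sq_sqrt hx
  have et := Real.sq_sqrt ht
  set X := √x
  set T := √t
  rw [← ex, ← et]
  nlinarith [mul_nonneg (sq_nonneg (X - T)) (add_nonneg hX (div_nonneg hT zero_le_two))]

variable {α E : Type*} [MeasurableSpace α] {μ : Measure α} [NormedAddCommGroup E]
  [InnerProductSpace ℝ E]

theorem dualL3_smul {c : ℝ} (hc : 0 ≤ c) (v : Lp E 3 μ) : dualL3 (c • v) = c ^ 2 • dualL3 v := by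
  refine Lp.ext ?_
  filter_upwards [coeFn_dualL3 (c • v), coeFn_dualL3 v, Lp.coeFn_smul c v,
    Lp.coeFn_smul (c ^ 2) (dualL3 v)] with x h1 h2 h3 h4
  rw [h1, h4, h3, Pi.smul_apply, Pi.smul_apply, h2, norm_smul, Real.norm_of_nonneg hc, smul_smul,
    smul_smul]
  ring_nf

theorem dualL32_smul {c : ℝ} (hc : 0 ≤ c) (w : Lp E (3 / 2) μ) :
    dualL32 (c • w) = √c • dualL32 w := by
  refine Lp.ext ?_
  filter_upwards [coeFn_dualL32 (c • w), coeFn_dualL32 w, Lp.coeFn_smul c w,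
    Lp.coeFn_smul √c (dualL32 w)] with x h1 h2 h3 h4
  rw [h1, h4, h3, Pi.smul_apply, Pi.smul_apply, h2, norm_smul, Real.norm_of_nonneg hc, smul_smul,
    smul_smul, Real.mul_rpow hc (norm_nonneg _), rpow_neg_half_eq c hc]
  congr 1
  rcases hc.eq_or_lt with rfl | h
  · simp
  · have := Real.sqrt_pos.2 h
    nth_rw 2 [← Real.sq_sqrt hc]
    field_simp

/-- The distance to `K` grows at least linearly along lines through a point that is nearest to the
origin modulo `K`. -/
theorem le_infDist_add_smul {K : Submodule ℝ (Lp E 3 μ)} {v : Lp E 3 μ} (hv : 0 < ‖v‖)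
    (h : ∀ g ∈ K, lpInner (dualL3 v) g = 0) (s : ℝ) (d : Lp E 3 μ) :
    ‖v‖ + s * lpInner (dualL3 v) d / ‖v‖ ^ 2 ≤ Metric.infDist (v + s • d) K := by
  refine (Metric.le_infDist ⟨0, K.zero_mem⟩).2 fun y hy => ?_
  -- Pairing with `dualL3 v`, which annihilates `K` and has norm ‖v‖², bounds the distance to every
  -- `y` in `K` at once.
  have h1 := (le_abs_self _).trans (abs_lpInner_le (dualL3 v) (v + s • d - y))
  rw [lpInner_sub_right, lpInner_add_right, lpInner_smul_right, h y hy, lpInner_dualL3_self,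
    norm_dualL3, ← dist_eq_norm] at h1
  refine le_of_mul_le_mul_left (h1.trans' (le_of_eq ?_)) (by positivity : 0 < ‖v‖ ^ 2)
  field_simp
  ring

/-- One-sided derivative estimate at an approximate minimizer in the sense of Ekeland. -/
theorem neg_le_derivative_of_ekeland {K : Submodule ℝ (Lp E 3 μ)} {v : Lp E 3 μ}
    {b : Lp E (3 / 2) μ} (hv : 0 < ‖v‖) (h : ∀ g ∈ K, lpInner (dualL3 v) g = 0)
    {S : ℝ} (hS : 0 ≤ S) {d : Lp E 3 μ} {k : Lp E (3 / 2) μ} {D : ℝ}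
    (hE : ∀ s : ℝ, 0 < s → s ≤ 1 → ‖b‖ ^ (3 / 2 : ℝ) - S * ‖v‖ ^ (3 / 2 : ℝ) ≤
      ‖b + s • k‖ ^ (3 / 2 : ℝ) - S * Metric.infDist (v + s • d) K ^ (3 / 2 : ℝ) + s * D) :
    -D ≤ 3 / 2 * (lpInner k (dualL32 b) - S * (√‖v‖ / ‖v‖ ^ 2 * lpInner (dualL3 v) d)) := by
  have : -D - 3 / 2 * (lpInner k (dualL32 b)
      - S * (√‖v‖ / ‖v‖ ^ 2 * lpInner (dualL3 v) d)) ≤ 0 := by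
    refine nonpos_of_forall_le_mul_sqrt (K := 5 * ‖k‖ ^ (3 / 2 : ℝ)) fun s hs hs1 => ?_
    have h1 := hE s hs hs1
    have h2 := norm_add_rpow_three_halves_le_Lp b (s • k)
    rw [lpInner_smul_left, norm_smul, Real.norm_of_nonneg hs.le,
      Real.mul_rpow hs.le (norm_nonneg _), rpow_three_halves_eq s hs.le,
      pow_succ, Real.sq_sqrt hs.le] at h2
    have h3 := tangent_le_rpow_three_halves (Metric.infDist_nonneg (x := v + s • d) (s := K))
      (norm_nonneg v)
    have h4 := le_infDist_add_smul hv h s d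
    have h5 : 3 / 2 * √‖v‖ * (s * lpInner (dualL3 v) d / ‖v‖ ^ 2) ≤
        3 / 2 * √‖v‖ * (Metric.infDist (v + s • d) K - ‖v‖) := by gcongr; linarith
    have h6 : S * (‖v‖ ^ (3 / 2 : ℝ) + 3 / 2 * √‖v‖ * (s * lpInner (dualL3 v) d / ‖v‖ ^ 2)) ≤
        S * Metric.infDist (v + s • d) K ^ (3 / 2 : ℝ) := by gcongr; linarith
    refine le_of_mul_le_mul_left ?_ hs
    have e : √‖v‖ * (s * lpInner (dualL3 v) d / ‖v‖ ^ 2)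
        = s * (√‖v‖ / ‖v‖ ^ 2 * lpInner (dualL3 v) d) := by ring
    rw [mul_add, mul_assoc (3 / 2 : ℝ), e] at h6
    linarith
  linarith

variable [CompleteSpace E]

/-- Approximate critical points of the Sobolev type quotient `‖p.2‖^{3/2} / dist(p.1, K)^{3/2}` on
a closed subspace of `L³ × L^{3/2}`, close to a given almost minimizer. -/
theorem exists_almost_critical {Γ : Submodule ℝ (Lp E 3 μ × Lp E (3 / 2) μ)}
    (hΓ : IsClosed (Γ : Set (Lp E 3 μ × Lp E (3 / 2) μ))) {K : Submodule ℝ (Lp E 3 μ)}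
    (hK : ∀ g ∈ K, (g, 0) ∈ Γ) {S : ℝ} (hS : 0 < S)
    (hSob : ∀ p ∈ Γ, S * Metric.infDist p.1 K ^ (3 / 2 : ℝ) ≤ ‖p.2‖ ^ (3 / 2 : ℝ))
    {p₀ : Lp E 3 μ × Lp E (3 / 2) μ} (hp₀ : p₀ ∈ Γ) (h1 : Metric.infDist p₀.1 K = 1)
    {η δ : ℝ} (hη : ‖p₀.2‖ ^ (3 / 2 : ℝ) ≤ S + η) (hδ : 0 < δ) (hηδ : 2 * η ≤ δ) :
    ∃ p ∈ Γ, ∃ r : Lp E 3 μ, ‖p.1‖ = 1 ∧ (∀ g ∈ K, lpInner (dualL3 p.1) g = 0) ∧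
      ‖p.2 - p₀.2‖ ≤ (2 * ‖p₀.2‖ + 3) * (η / δ) ∧
      ‖r‖ ≤ 2 * ((1 / S) ^ (2 / 3 : ℝ) + 1) * δ ∧
      ∀ q ∈ Γ, lpInner q.2 (dualL32 p.2) - S * lpInner (dualL3 p.1) q.1 = lpInner q.2 r := by
  set c := (1 / S) ^ (2 / 3 : ℝ)
  have hc : 0 ≤ c := by positivity
  have hcS : c ^ (3 / 2 : ℝ) = 1 / S := by
    rw [← Real.rpow_mul (by positivity)]; norm_num
  set N : Lp E 3 μ → ℝ := fun a => Metric.infDist a K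
  set K' := K.topologicalClosure with hK'
  have hN : ∀ a, N a = Metric.infDist a K' := fun a => Metric.infDist_closure.symm
  -- Nearest points lie only in the closure of `K`; since Γ is closed, subtracting them stays in Γ
  -- and leaves the second component unchanged.
  have hKΓ : ∀ g ∈ K', (g, (0 : Lp E (3 / 2) μ)) ∈ Γ := fun g hg =>
    closure_minimal (t := (fun g : Lp E 3 μ => (g, (0 : Lp E (3 / 2) μ))) ⁻¹' Γ) hK
      (hΓ.preimage (by fun_prop)) hg
  have hNadd : ∀ a, ∀ g ∈ K', N (a + g) = N a := fun a g hg => by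
    rw [hN, hN, infDist_add_mem hg]
  have : CompleteSpace Γ := hΓ.completeSpace_coe
  set J : Γ → ℝ := fun p => ‖p.1.2‖ ^ (3 / 2 : ℝ) - S * N p.1.1 ^ (3 / 2 : ℝ)
  have hJc : Continuous J := by
    have h2 : Continuous fun p : Γ => N p.1.1 :=
      (Metric.continuous_infDist_pt _).comp (by fun_prop)
    have h3 : Continuous fun p : Γ => ‖p.1.2‖ := by fun_prop
    exact (h3.rpow_const fun _ => Or.inr (by norm_num)).sub
      ((h2.rpow_const fun _ => Or.inr (by norm_num)).const_mul S)
  obtain ⟨⟨⟨a, b⟩, hab⟩, hx1, hx2⟩ := ekeland_variational_principle hJc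
    (fun p => sub_nonneg.2 (hSob p p.2)) hδ ⟨p₀, hp₀⟩
  have hJ0 : J ⟨p₀, hp₀⟩ ≤ η := by
    simp only [J, N, h1, Real.one_rpow]
    linarith
  have hJx : 0 ≤ J ⟨(a, b), hab⟩ := sub_nonneg.2 (hSob _ hab)
  set e := η / δ with he
  -- Ekeland's principle moves `p₀` by at most η/δ; keeping this below 1/2 keeps the distance to `K`
  -- away from 0, so that one can normalize.
  have he2 : e ≤ 1 / 2 := by rw [he, div_le_iff₀ hδ]; linarith
  have hdist : dist p₀ (a, b) ≤ e := by
    rw [he, le_div_iff₀ hδ]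
    rw [Subtype.dist_eq] at hx1
    linarith
  have hd1 : dist p₀.1 a ≤ e := (le_max_left _ _).trans hdist
  have hd2 : ‖b - p₀.2‖ ≤ e := by
    rw [← dist_eq_norm, dist_comm]; exact (le_max_right _ _).trans hdist
  have ht1 : |N a - 1| ≤ e := by
    have := (Metric.lipschitz_infDist_pt (K : Set (Lp E 3 μ))).dist_le_mul a p₀.1
    rw [h1, Real.dist_eq, dist_comm] at this
    simpa using this.trans (by simpa using hd1)
  obtain ⟨g₀, hg₀, hnear⟩ := exists_mem_closure_norm_sub_eq_infDist K a
  set v := a - g₀ with hv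
  have hvt : ‖v‖ = N a := hnear
  have hNv : N v = ‖v‖ := by
    rw [hvt, hv, sub_eq_add_neg]
    exact hNadd a _ (K'.neg_mem hg₀)
  have ht2 : 1 / 2 ≤ ‖v‖ := by rw [hvt]; linarith [(abs_le.1 ht1).1]
  have ht0 : 0 < ‖v‖ := by linarith
  have horth : ∀ g ∈ K', lpInner (dualL3 v) g = 0 := fun g hg =>
    lpInner_dualL3_eq_zero (K := K') (fun g hg => by
      rw [← hNv, ← hNadd v g hg]
      exact (Metric.infDist_le_dist_of_mem K.zero_mem).trans_eq (dist_zero_right _)) hg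
  have hvb : (v, b) ∈ Γ := by
    simpa [hv] using Γ.sub_mem hab (hKΓ g₀ hg₀)
  -- the derivative estimate
  set κ := √‖v‖ / ‖v‖ ^ 2
  have hder : ∀ q ∈ Γ, -(δ * ((c + 1) * ‖q.2‖)) ≤
      3 / 2 * (lpInner q.2 (dualL32 b) - S * (κ * lpInner (dualL3 v) q.1)) := by
    rintro ⟨d, k⟩ hq
    refine neg_le_derivative_of_ekeland (K := K) ht0
      (fun g hg => horth g (K.le_topologicalClosure hg)) hS.le fun s hs _ => ?_
    -- The direction is shifted by a nearest point so that its L³ norm is controlled by ‖k‖ alone;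
    -- the distance to `K` does not see the shift. This makes the final functional bounded in terms
    -- of the second component only.
    obtain ⟨g, hg, hgd⟩ := exists_mem_closure_norm_sub_eq_infDist K d
    have hdk : ‖d - g‖ ≤ c * ‖k‖ := by
      rw [hgd]
      have := hSob _ hq
      refine (Real.rpow_le_rpow_iff Metric.infDist_nonneg (by positivity)
        (show (0 : ℝ) < 3 / 2 by norm_num)).1 ?_
      rw [Real.mul_rpow hc (norm_nonneg _), hcS, one_div, ← div_eq_inv_mul, le_div_iff₀ hS,
        mul_comm]
      exact this
    have hq' : (d - g, k) ∈ Γ := by simpa using Γ.sub_mem hq (hKΓ g hg)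
    have hy := hx2 ⟨_, Γ.add_mem hab (Γ.smul_mem s hq')⟩
    have hnorm : dist (⟨(a, b), hab⟩ : Γ) ⟨_, Γ.add_mem hab (Γ.smul_mem s hq')⟩
        ≤ s * ((c + 1) * ‖k‖) := by
      rw [Subtype.dist_eq, dist_eq_norm]
      simp only [sub_add_cancel_left, norm_neg, norm_smul, Real.norm_of_nonneg hs.le]
      gcongr
      refine max_le (hdk.trans ?_) ?_ <;> nlinarith [norm_nonneg k]
    have hNs : N (a + s • (d - g)) = N (v + s • d) := by
      rw [← hNadd (v + s • d) (g₀ - s • g) (K'.sub_mem hg₀ (K'.smul_mem s hg))]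
      congr 1
      rw [hv]; module
    simp only [J, Prod.fst_add, Prod.snd_add, Prod.smul_fst, Prod.smul_snd] at hy
    rw [hNs, ← hvt] at hy
    have := mul_le_mul_of_nonneg_left hnorm hδ.le
    refine (hy.trans (add_le_add le_rfl this)).trans_eq ?_
    simp only [N]
    ring
  -- the representing field
  set ℓ : Γ →ₗ[ℝ] ℝ :=
    { toFun := fun q => lpInner q.1.2 (dualL32 b)
        - S * (κ * lpInner (dualL3 v) q.1.1)
      map_add' := fun x y => by
        simp only [Submodule.coe_add, Prod.fst_add, Prod.snd_add, lpInner_add_left,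
          lpInner_add_right]
        ring
      map_smul' := fun t x => by
        simp only [Submodule.coe_smul, Prod.smul_fst, Prod.smul_snd, lpInner_smul_left,
          lpInner_smul_right, RingHom.id_apply, smul_eq_mul]
        ring } with hℓ
  have hℓle : ∀ q : Γ, |ℓ q| ≤ δ * (c + 1) * ‖q.1.2‖ := by
    intro q
    have h2 : -(δ * ((c + 1) * ‖q.1.2‖)) ≤ 3 / 2 * ℓ q := hder q q.2
    have h3 : -(δ * ((c + 1) * ‖(-q : Γ).1.2‖)) ≤ 3 / 2 * ℓ (-q) := hder _ (-q).2
    rw [map_neg, Submodule.coe_neg, Prod.snd_neg, norm_neg] at h3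
    have : 0 ≤ δ * ((c + 1) * ‖q.1.2‖) := by positivity
    rw [abs_le]
    constructor <;> linarith
  obtain ⟨G, hG1, hG2⟩ := exists_strongDual_comp_eq
    (LinearMap.snd ℝ (Lp E 3 μ) (Lp E (3 / 2) μ) ∘ₗ Γ.subtype) ℓ (by positivity) hℓle
  obtain ⟨ρ, hρ1, hρ2⟩ := exists_forall_eq_lpInner G
  have hs0 : 0 < √‖v‖ := Real.sqrt_pos.2 ht0
  have hs1 : (√‖v‖)⁻¹ ≤ 2 := by
    rw [inv_le_comm₀ hs0 (by norm_num)]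
    exact Real.le_sqrt_of_sq_le (by linarith)
  -- Under this normalization `dualL3` scales quadratically and `dualL32` by a square root, so
  -- dividing the identity by √‖v‖ absorbs κ exactly.
  refine ⟨‖v‖⁻¹ • (v, b), Γ.smul_mem _ hvb, (√‖v‖)⁻¹ • ρ, ?_, ?_, ?_, ?_, ?_⟩
  · simp [norm_smul, ht0.ne']
  · intro g hg
    rw [Prod.smul_fst, dualL3_smul (by positivity), lpInner_smul_left,
      horth g (K.le_topologicalClosure hg), mul_zero]
  · have e1 : ‖v‖⁻¹ • b - p₀.2 = (‖v‖⁻¹ * (1 - ‖v‖)) • b + (b - p₀.2) := by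
      have : ‖v‖⁻¹ = ‖v‖⁻¹ * (1 - ‖v‖) + 1 := by field_simp; ring
      nth_rw 1 [this]
      module
    have hb : ‖b‖ ≤ ‖p₀.2‖ + 1 := by
      have := norm_add_le p₀.2 (b - p₀.2)
      rw [add_sub_cancel] at this
      linarith
    have hi : ‖v‖⁻¹ ≤ 2 := by rw [inv_le_comm₀ ht0 (by norm_num)]; linarith
    have he0 : 0 ≤ e := dist_nonneg.trans hdist
    calc ‖‖v‖⁻¹ • b - p₀.2‖ ≤ ‖v‖⁻¹ * |1 - ‖v‖| * ‖b‖ + ‖b - p₀.2‖ := by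
          rw [e1]
          refine (norm_add_le _ _).trans_eq ?_
          rw [norm_smul, Real.norm_eq_abs, abs_mul, abs_of_pos (inv_pos.2 ht0)]
      _ ≤ 2 * e * (‖p₀.2‖ + 1) + e := by
          rw [abs_sub_comm]
          gcongr
          rw [hvt]; exact ht1
      _ = _ := by ring
  · rw [norm_smul, Real.norm_of_nonneg (by positivity)]
    calc _ ≤ 2 * (δ * (c + 1)) := by gcongr; exact hρ1.trans hG1
      _ = _ := by ring
  · intro q hq
    have h2 := hG2 ⟨q, hq⟩
    rw [hρ2] at h2
    have h3 : lpInner q.2 ρ = lpInner q.2 (dualL32 b) - S * (κ * lpInner (dualL3 v) q.1) := h2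
    have hr : ∀ (t : ℝ) (x : Lp E 3 μ), lpInner q.2 (t • x) = t * lpInner q.2 x := fun t x =>
      lpInner_smul_right t _ x
    rw [Prod.smul_fst, Prod.smul_snd, dualL3_smul (by positivity), dualL32_smul (by positivity),
      hr, hr, lpInner_smul_left, h3, Real.sqrt_inv]
    simp only [κ]
    field_simp

end AlmostCritical

/-! ### Test fields, weak curls and weak gradients -/

namespace CurlSobolev

/-- The partial derivative `∂_i f` of a scalar function. -/
def pderiv (i : Fin 3) (f : E3 → ℝ) (x : E3) : ℝ := fderiv ℝ f x (EuclideanSpace.single i 1)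

theorem inner_E3 (x y : E3) : inner ℝ x y = x 0 * y 0 + x 1 * y 1 + x 2 * y 2 := by
  simp [PiLp.inner_apply, Fin.sum_univ_three, mul_comm]

theorem integral_add_add {f g h : E3 → ℝ} (hf : Integrable f) (hg : Integrable g)
    (hh : Integrable h) :
    ∫ x, f x + g x + h x = (∫ x, f x) + (∫ x, g x) + ∫ x, h x := by
  have : Integrable fun x => f x + g x := hf.add hg
  rw [integral_add this hh, integral_add hf hg]

theorem IsTest.comp_apply {V : E3 → E3} (hV : IsTest V) (j : Fin 3) : IsTest fun x => V x j :=
  ⟨contDiff_euclidean.1 hV.1 j, hV.2.comp_left (g := fun y : E3 => y j) rfl⟩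

theorem IsTest.isTest_pderiv {f : E3 → ℝ} (hf : IsTest f) (i : Fin 3) : IsTest (pderiv i f) :=
  ⟨(hf.1.fderiv_right (m := ∞) (by simp)).clm_apply contDiff_const, hf.2.fderiv_apply ℝ _⟩

theorem IsTest.sub {F : Type*} [NormedAddCommGroup F] [NormedSpace ℝ F] {f g : E3 → F}
    (hf : IsTest f) (hg : IsTest g) : IsTest fun x => f x - g x :=
  ⟨hf.1.sub hg.1, hf.2.sub hg.2⟩

theorem IsTest.mul {f g : E3 → ℝ} (hf : IsTest f) (hg : IsTest g) : IsTest fun x => f x * g x :=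
  ⟨hf.1.mul hg.1, hf.2.mul_right⟩

theorem IsTest.memLp {F : Type*} [NormedAddCommGroup F] [NormedSpace ℝ F] {f : E3 → F}
    (hf : IsTest f) (p : ℝ≥0∞) : MemLp f p :=
  hf.1.continuous.memLp_of_hasCompactSupport hf.2

theorem IsTest.integrable {F : Type*} [NormedAddCommGroup F] [NormedSpace ℝ F] {f : E3 → F}
    (hf : IsTest f) : Integrable f :=
  hf.1.continuous.integrable_of_hasCompactSupport hf.2

theorem IsTest.differentiable {F : Type*} [NormedAddCommGroup F] [NormedSpace ℝ F] {f : E3 → F}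
    (hf : IsTest f) : Differentiable ℝ f :=
  hf.1.differentiable (by simp)

theorem partialDeriv_eq {V : E3 → E3} (hV : IsTest V) (i j : Fin 3) :
    partialDeriv i j V = pderiv i fun x => V x j := by
  funext x
  have h := ((EuclideanSpace.proj j : E3 →L[ℝ] ℝ).hasFDerivAt.comp x
    (hV.differentiable x).hasFDerivAt).fderiv
  change fderiv ℝ (fun x => V x j) x = _ at h
  rw [pderiv, h]
  rfl

theorem curl_apply_zero {V : E3 → E3} (hV : IsTest V) :
    (fun x => curl V x 0) = fun x => pderiv 1 (fun x => V x 2) x - pderiv 2 (fun x => V x 1) x := by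
  simp [curl, partialDeriv_eq hV]

theorem curl_apply_one {V : E3 → E3} (hV : IsTest V) :
    (fun x => curl V x 1) = fun x => pderiv 2 (fun x => V x 0) x - pderiv 0 (fun x => V x 2) x := by
  simp [curl, partialDeriv_eq hV]

theorem curl_apply_two {V : E3 → E3} (hV : IsTest V) :
    (fun x => curl V x 2) = fun x => pderiv 0 (fun x => V x 1) x - pderiv 1 (fun x => V x 0) x := by
  simp [curl, partialDeriv_eq hV]

theorem IsTest.curl_apply {V : E3 → E3} (hV : IsTest V) (i : Fin 3) :
    IsTest fun x => curl V x i := by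
  have h := fun i j => (hV.comp_apply j).isTest_pderiv i
  fin_cases i
  · exact (curl_apply_zero hV) ▸ (h 1 2).sub (h 2 1)
  · exact (curl_apply_one hV) ▸ (h 2 0).sub (h 0 2)
  · exact (curl_apply_two hV) ▸ (h 0 1).sub (h 1 0)

theorem isTest_of_forall_apply {V : E3 → E3} (h : ∀ i, IsTest fun x => V x i) : IsTest V := by
  refine ⟨contDiff_euclidean.2 fun i => (h i).1, ?_⟩
  refine HasCompactSupport.of_support_subset_isCompact
    (isCompact_iUnion fun i => (h i).2.isCompact) fun x hx => ?_
  obtain ⟨i, hi⟩ : ∃ i, V x i ≠ 0 := by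
    by_contra! hc
    exact hx (by ext i; simpa using hc i)
  exact Set.mem_iUnion.2 ⟨i, subset_tsupport _ hi⟩

theorem IsTest.isTest_curl {V : E3 → E3} (hV : IsTest V) : IsTest (curl V) :=
  isTest_of_forall_apply hV.curl_apply

theorem gradient_apply (f : E3 → ℝ) (x : E3) (i : Fin 3) : gradient f x i = pderiv i f x := by
  rw [pderiv, ← inner_gradient_left]
  rw [EuclideanSpace.inner_single_right]
  simp

theorem IsTest.isTest_gradient {f : E3 → ℝ} (hf : IsTest f) : IsTest (gradient f) :=
  isTest_of_forall_apply fun i => by simpa only [gradient_apply] using hf.isTest_pderiv i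

/-- Integration by parts for test functions. -/
theorem integral_mul_pderiv {f g : E3 → ℝ} (hf : IsTest f) (hg : IsTest g) (i : Fin 3) :
    ∫ x, f x * pderiv i g x = -∫ x, pderiv i f x * g x :=
  integral_mul_fderiv_eq_neg_fderiv_mul_of_integrable ((hf.isTest_pderiv i).mul hg).integrable
    (hf.mul (hg.isTest_pderiv i)).integrable (hf.mul hg).integrable
    (fun x _ => hf.differentiable x) (fun x _ => hg.differentiable x)

/-- The weak curl of a test field is its classical curl. -/
theorem IsTest.hasWeakCurl {V : E3 → E3} (hV : IsTest V) : HasWeakCurl V (curl V) := by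
  refine ⟨hV.integrable.locallyIntegrable, hV.isTest_curl.integrable.locallyIntegrable, fun Φ hΦ => ?_⟩
  have e0 := fun x => congrFun (curl_apply_zero hΦ) x
  have e1 := fun x => congrFun (curl_apply_one hΦ) x
  have e2 := fun x => congrFun (curl_apply_two hΦ) x
  have f0 := fun x => congrFun (curl_apply_zero hV) x
  have f1 := fun x => congrFun (curl_apply_one hV) x
  have f2 := fun x => congrFun (curl_apply_two hV) x
  simp only at e0 e1 e2 f0 f1 f2
  simp only [inner_E3, e0, e1, e2, f0, f1, f2]
  set c : Fin 3 → E3 → ℝ := fun j x => V x j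
  set d : Fin 3 → E3 → ℝ := fun j x => Φ x j
  have hc : ∀ j, IsTest (c j) := hV.comp_apply
  have hd : ∀ j, IsTest (d j) := hΦ.comp_apply
  have hI : ∀ a i b, Integrable fun x => c a x * pderiv i (d b) x := fun a i b =>
    ((hc a).mul ((hd b).isTest_pderiv i)).integrable
  have hJ : ∀ i a b, Integrable fun x => pderiv i (c a) x * d b x := fun i a b =>
    (((hc a).isTest_pderiv i).mul (hd b)).integrable
  have hL : ∀ a b i k l, Integrable fun x => c a x * (pderiv i (d b) x - pderiv k (d l) x) :=
    fun a b i k l => by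
      simp only [mul_sub]
      exact (hI a i b).sub (hI a k l)
  have hR : ∀ a b i k l, Integrable fun x => (pderiv i (c b) x - pderiv k (c l) x) * d a x :=
    fun a b i k l => by
      simp only [sub_mul]
      exact (hJ i b a).sub (hJ k l a)
  change ∫ x, c 0 x * (pderiv 1 (d 2) x - pderiv 2 (d 1) x)
      + c 1 x * (pderiv 2 (d 0) x - pderiv 0 (d 2) x)
      + c 2 x * (pderiv 0 (d 1) x - pderiv 1 (d 0) x)
    = ∫ x, (pderiv 1 (c 2) x - pderiv 2 (c 1) x) * d 0 x
      + (pderiv 2 (c 0) x - pderiv 0 (c 2) x) * d 1 x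
      + (pderiv 0 (c 1) x - pderiv 1 (c 0) x) * d 2 x
  have hs : ∀ a b i k l, ∫ x, c a x * (pderiv i (d b) x - pderiv k (d l) x)
      = (∫ x, c a x * pderiv i (d b) x) - ∫ x, c a x * pderiv k (d l) x := fun a b i k l => by
    simp only [mul_sub]
    exact integral_sub (hI a i b) (hI a k l)
  have ht : ∀ a b i k l, ∫ x, (pderiv i (c b) x - pderiv k (c l) x) * d a x
      = (∫ x, pderiv i (c b) x * d a x) - ∫ x, pderiv k (c l) x * d a x := fun a b i k l => by
    simp only [sub_mul]
    exact integral_sub (hJ i b a) (hJ k l a)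
  rw [integral_add_add (hL _ _ _ _ _) (hL _ _ _ _ _) (hL _ _ _ _ _),
    integral_add_add (hR _ _ _ _ _) (hR _ _ _ _ _) (hR _ _ _ _ _)]
  simp only [hs, ht, integral_mul_pderiv (hc _) (hd _)]
  ring

theorem pderiv_comm {f : E3 → ℝ} (hf : IsTest f) (i j : Fin 3) (x : E3) :
    pderiv i (pderiv j f) x = pderiv j (pderiv i f) x := by
  have hd : DifferentiableAt ℝ (fderiv ℝ f) x :=
    (hf.1.fderiv_right (m := 1) (by norm_cast)).differentiable (by simp) x
  have h : ∀ i j, pderiv i (pderiv j f) x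
      = fderiv ℝ (fderiv ℝ f) x (EuclideanSpace.single i 1) (EuclideanSpace.single j 1) := by
    intro i j
    change fderiv ℝ (fun y => fderiv ℝ f y (EuclideanSpace.single j 1)) x _ = _
    rw [fderiv_clm_apply hd (differentiableAt_const _)]
    simp
  rw [h, h]
  exact (hf.1.contDiffAt.isSymmSndFDerivAt (by
    rw [minSmoothness_of_isRCLikeNormedField]
    exact WithTop.coe_le_coe.2 (le_top (a := (2 : ℕ∞))))) _ _

theorem pderiv_sub {f g : E3 → ℝ} (hf : IsTest f) (hg : IsTest g) (i : Fin 3) (x : E3) :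
    pderiv i (fun x => f x - g x) x = pderiv i f x - pderiv i g x := by
  rw [pderiv, fderiv_fun_sub (hf.differentiable x) (hg.differentiable x)]
  rfl

/-- The divergence of a curl vanishes. -/
theorem div_curl {V : E3 → E3} (hV : IsTest V) (x : E3) :
    pderiv 0 (fun x => curl V x 0) x + pderiv 1 (fun x => curl V x 1) x
      + pderiv 2 (fun x => curl V x 2) x = 0 := by
  have h := fun i j => (hV.comp_apply j).isTest_pderiv i
  rw [curl_apply_zero hV, curl_apply_one hV, curl_apply_two hV, pderiv_sub (h _ _) (h _ _),
    pderiv_sub (h _ _) (h _ _), pderiv_sub (h _ _) (h _ _), pderiv_comm (hV.comp_apply 2) 1 0,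
    pderiv_comm (hV.comp_apply 1) 2 0, pderiv_comm (hV.comp_apply 0) 2 1]
  ring

theorem IsTest.hasWeakGradient {f : E3 → ℝ} (hf : IsTest f) :
    HasWeakGradient f (gradient f) := by
  refine ⟨hf.integrable.locallyIntegrable, hf.isTest_gradient.integrable.locallyIntegrable,
    fun η hη => ?_⟩
  ext i
  rw [PiLp.neg_apply, eval_integral_piLp, eval_integral_piLp]
  · simp only [PiLp.smul_apply, smul_eq_mul, gradient_apply]
    rw [integral_mul_pderiv hf hη]
    simp only [mul_comm]
  · intro j
    simp only [PiLp.smul_apply, smul_eq_mul, gradient_apply]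
    exact (hη.mul (hf.isTest_pderiv j)).integrable
  · intro j
    simp only [PiLp.smul_apply, smul_eq_mul, gradient_apply]
    exact (hf.mul (hη.isTest_pderiv j)).integrable

theorem locallyIntegrable_apply {V : E3 → E3} (hV : LocallyIntegrable V) (i : Fin 3) :
    LocallyIntegrable fun x => V x i := fun x => by
  obtain ⟨s, hs, h⟩ := hV x
  exact ⟨s, hs, (EuclideanSpace.proj (𝕜 := ℝ) i).integrable_comp h⟩

theorem _root_.MeasureTheory.LocallyIntegrable.integrable_mul_isTest {f g : E3 → ℝ}
    (hf : LocallyIntegrable f) (hg : IsTest g) : Integrable fun x => f x * g x :=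
  hf.integrable_smul_right_of_hasCompactSupport hg.1.continuous hg.2

/-- Weak gradients have weak curl `0`. -/
theorem HasWeakGradient.hasWeakCurl_zero {φ : E3 → ℝ} {G : E3 → E3} (h : HasWeakGradient φ G) :
    HasWeakCurl G 0 := by
  refine ⟨h.2.1, locallyIntegrable_zero, fun Φ hΦ => ?_⟩
  have hc := hΦ.curl_apply
  have hG := locallyIntegrable_apply h.2.1
  -- The components of `curl Φ` serve as scalar test functions for the weak gradient; summing over
  -- them leaves φ against the divergence of a curl.
  have key : ∀ i, ∫ x, G x i * curl Φ x i = -∫ x, φ x * pderiv i (fun x => curl Φ x i) x := by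
    intro i
    have := congrArg (fun v : E3 => v i) (h.2.2 _ (hc i))
    simp only [PiLp.neg_apply] at this
    rw [eval_integral_piLp, eval_integral_piLp] at this
    · simp only [PiLp.smul_apply, smul_eq_mul, gradient_apply] at this
      rw [this, neg_neg]
      simp only [mul_comm]
    · intro j
      simp only [PiLp.smul_apply, smul_eq_mul, mul_comm]
      exact (hG j).integrable_mul_isTest (hc i)
    · intro j
      simp only [PiLp.smul_apply, smul_eq_mul, gradient_apply]
      exact h.1.integrable_mul_isTest ((hc i).isTest_pderiv j)
  have hI : ∀ i, Integrable fun x => G x i * curl Φ x i := fun i =>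
    (hG i).integrable_mul_isTest (hc i)
  have hJ : ∀ i, Integrable fun x => φ x * pderiv i (fun x => curl Φ x i) x := fun i =>
    h.1.integrable_mul_isTest ((hc i).isTest_pderiv i)
  simp only [inner_E3, Pi.zero_apply, PiLp.zero_apply, zero_mul, add_zero, integral_zero]
  rw [integral_add_add (hI 0) (hI 1) (hI 2), key, key, key, ← neg_add, ← neg_add,
    ← integral_add_add (hJ 0) (hJ 1) (hJ 2), neg_eq_zero]
  simp only [← mul_add, div_curl hΦ, mul_zero, integral_zero]

end CurlSobolev

/-! ### The space of gradients and the graph of the weak curl -/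

namespace CurlSobolev

theorem HasWeakGradient.congr_ae {φ : E3 → ℝ} {G G' : E3 → E3} (h : HasWeakGradient φ G)
    (hG : G =ᵐ[volume] G') : HasWeakGradient φ G' := by
  refine ⟨h.1, h.2.1.congr hG, fun η hη => (h.2.2 η hη).trans ?_⟩
  congr 1
  exact integral_congr_ae (hG.mono fun x hx => by simp only [hx])

theorem HasWeakGradient.add {φ ψ : E3 → ℝ} {G H : E3 → E3} (h : HasWeakGradient φ G)
    (h' : HasWeakGradient ψ H) : HasWeakGradient (φ + ψ) (G + H) := by
  refine ⟨h.1.add h'.1, h.2.1.add h'.2.1, fun η hη => ?_⟩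
  have hg := hη.isTest_gradient
  simp only [Pi.add_apply, add_smul, smul_add]
  rw [integral_add (h.1.integrable_smul_right_of_hasCompactSupport hg.1.continuous hg.2)
      (h'.1.integrable_smul_right_of_hasCompactSupport hg.1.continuous hg.2),
    integral_add (h.2.1.integrable_smul_left_of_hasCompactSupport hη.1.continuous hη.2)
      (h'.2.1.integrable_smul_left_of_hasCompactSupport hη.1.continuous hη.2),
    h.2.2 η hη, h'.2.2 η hη, neg_add]

theorem HasWeakGradient.const_smul {φ : E3 → ℝ} {G : E3 → E3} (h : HasWeakGradient φ G) (c : ℝ) :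
    HasWeakGradient (c • φ) (c • G) := by
  refine ⟨h.1.smul c, h.2.1.smul c, fun η hη => ?_⟩
  simp only [Pi.smul_apply, smul_comm _ c, smul_assoc]
  rw [integral_smul, integral_smul, h.2.2 η hη, smul_neg]

/-- The subspace of gradients in `L³`. -/
def gradientSubmodule : Submodule ℝ (Lp E3 3 (volume : Measure E3)) where
  carrier := {g | ∃ φ, HasWeakGradient φ g}
  zero_mem' := by
    refine ⟨0, HasWeakGradient.congr_ae (G := 0) ?_ (Lp.coeFn_zero _ _ _).symm⟩
    exact ⟨locallyIntegrable_zero, locallyIntegrable_zero, fun η _ => by simp⟩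
  add_mem' := by
    rintro f g ⟨φ, hφ⟩ ⟨ψ, hψ⟩
    exact ⟨_, (hφ.add hψ).congr_ae (Lp.coeFn_add f g).symm⟩
  smul_mem' := by
    rintro c f ⟨φ, hφ⟩
    exact ⟨_, (hφ.const_smul c).congr_ae (Lp.coeFn_smul c f).symm⟩

theorem lpInner_toLp_right {f : E3 → E3} (hf : MemLp f 3)
    (w : Lp E3 (3 / 2) (volume : Measure E3)) :
    lpInner w (hf.toLp f) = ∫ x, inner ℝ (w x) (f x) :=
  integral_congr_ae (hf.coeFn_toLp.mono fun x hx => by simp only [hx])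

theorem lpInner_toLp_left {f : E3 → E3} (hf : MemLp f (3 / 2))
    (v : Lp E3 3 (volume : Measure E3)) :
    lpInner (hf.toLp f) v = ∫ x, inner ℝ (v x) (f x) :=
  integral_congr_ae (hf.coeFn_toLp.mono fun x hx => by simp only [hx, real_inner_comm])

/-- The graph of the weak curl in `L³ × L^{3/2}`. -/
def curlGraph : Submodule ℝ
    (Lp E3 3 (volume : Measure E3) × Lp E3 (3 / 2) (volume : Measure E3)) where
  carrier := {p | ∀ (Φ : E3 → E3) (hΦ : IsTest Φ),
    lpInner ((hΦ.isTest_curl.memLp (3 / 2)).toLp) p.1 = lpInner p.2 ((hΦ.memLp 3).toLp)}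
  zero_mem' := fun Φ hΦ => by
    have h1 := lpInner_smul_right 0 ((hΦ.isTest_curl.memLp (3 / 2)).toLp) 0
    have h2 := lpInner_smul_left 0 0 ((hΦ.memLp 3).toLp)
    rw [zero_smul, zero_mul] at h1 h2
    exact h1.trans h2.symm
  add_mem' := fun {p q} hp hq Φ hΦ => by
    rw [Prod.fst_add, Prod.snd_add, lpInner_add_right, lpInner_add_left, hp Φ hΦ, hq Φ hΦ]
  smul_mem' := fun c p hp Φ hΦ => by
    rw [Prod.smul_fst, Prod.smul_snd, lpInner_smul_right, lpInner_smul_left, hp Φ hΦ]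

/-- Each test field imposes one equation between continuous linear functionals. -/
theorem isClosed_curlGraph :
    IsClosed (curlGraph : Set (Lp E3 3 (volume : Measure E3) × Lp E3 (3 / 2) (volume : Measure E3))) := by
  simp only [curlGraph, Submodule.coe_set_mk, AddSubmonoid.coe_set_mk, AddSubsemigroup.coe_set_mk,
    Set.ofPred_forall]
  exact isClosed_iInter fun Φ => isClosed_iInter fun hΦ => isClosed_eq
    ((continuous_lpInner_right _).comp continuous_fst)
    ((continuous_lpInner_left _).comp continuous_snd)

theorem mem_curlGraph_iff {p : Lp E3 3 (volume : Measure E3) × Lp E3 (3 / 2) (volume : Measure E3)} :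
    p ∈ curlGraph ↔ HasWeakCurl p.1 p.2 := by
  have h : p ∈ curlGraph ↔ ∀ (Φ : E3 → E3) (hΦ : IsTest Φ),
    lpInner ((hΦ.isTest_curl.memLp (3 / 2)).toLp) p.1 = lpInner p.2 ((hΦ.memLp 3).toLp) := Iff.rfl
  simp only [h, lpInner_toLp_left, lpInner_toLp_right]
  exact ⟨fun h => ⟨(Lp.memLp p.1).locallyIntegrable Fact.out,
    (Lp.memLp p.2).locallyIntegrable Fact.out, h⟩, fun h => h.2.2⟩

theorem HasWeakCurl.congr_ae {A A' B B' : E3 → E3} (h : HasWeakCurl A B) (hA : A =ᵐ[volume] A')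
    (hB : B =ᵐ[volume] B') : HasWeakCurl A' B' := by
  refine ⟨h.1.congr hA, h.2.1.congr hB, fun Φ hΦ => ?_⟩
  have h1 : ∫ x, inner ℝ (A x) (curl Φ x) = ∫ x, inner ℝ (A' x) (curl Φ x) :=
    integral_congr_ae (hA.mono fun x hx => by simp only [hx])
  have h2 : ∫ x, inner ℝ (B x) (Φ x) = ∫ x, inner ℝ (B' x) (Φ x) :=
    integral_congr_ae (hB.mono fun x hx => by simp only [hx])
  rw [← h1, ← h2, h.2.2 Φ hΦ]

theorem HasWeakCurl.mem_curlGraph {A B : E3 → E3} (h : HasWeakCurl A B)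
    (hA : MemLp A 3 volume) (hB : MemLp B (3 / 2) volume) : (hA.toLp, hB.toLp) ∈ curlGraph :=
  mem_curlGraph_iff.2 (h.congr_ae hA.coeFn_toLp.symm hB.coeFn_toLp.symm)

theorem prod_zero_mem_curlGraph {g : Lp E3 3 (volume : Measure E3)} (hg : g ∈ gradientSubmodule) :
    (g, 0) ∈ curlGraph := by
  obtain ⟨φ, hφ⟩ := hg
  exact mem_curlGraph_iff.2
    (hφ.hasWeakCurl_zero.congr_ae (EventuallyEq.refl _ _) (Lp.coeFn_zero _ _ _).symm)

theorem lpNorm_eq_norm_toLp {f : E3 → E3} {p : ℝ≥0∞} (hf : MemLp f p) :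
    lpNorm f p volume = ‖hf.toLp f‖ := by
  rw [Lp.norm_toLp, toReal_eLpNorm hf.1]

theorem gaugeSeminorm_eq_infDist {A : E3 → E3} (hA : MemLp A 3) :
    gaugeSeminorm A = Metric.infDist (hA.toLp A) gradientSubmodule := by
  rw [gaugeSeminorm, Metric.infDist_eq_iInf, iInf]
  congr 1
  ext r
  constructor
  · rintro ⟨φ, G, hφ, hG, rfl⟩
    refine ⟨⟨hG.toLp, φ, hφ.congr_ae hG.coeFn_toLp.symm⟩, ?_⟩
    rw [lpNorm_eq_norm_toLp (hA.sub hG), MemLp.toLp_sub hA hG]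
    exact dist_eq_norm _ _
  · rintro ⟨⟨g, φ, hφ⟩, rfl⟩
    refine ⟨φ, g, hφ, Lp.memLp g, ?_⟩
    rw [lpNorm_eq_norm_toLp (hA.sub (Lp.memLp g)), MemLp.toLp_sub hA (Lp.memLp g), Lp.toLp_coeFn]
    exact dist_eq_norm _ _

theorem MemY.hasWeakCurl {A : E3 → E3} (hA : MemY A) : HasWeakCurl A (weakCurl A) := by
  obtain ⟨-, B, -, h⟩ := hA
  exact h.weakCurl

theorem MemY.memLp_weakCurl {A : E3 → E3} (hA : MemY A) : MemLp (weakCurl A) (3 / 2) := by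
  obtain ⟨-, B, hB, h⟩ := hA
  exact hB.ae_eq (h.ae_eq h.weakCurl)

theorem gaugeSeminorm_nonneg (A : E3 → E3) : 0 ≤ gaugeSeminorm A :=
  Real.sInf_nonneg (by rintro _ ⟨_, _, _, _, rfl⟩; exact lpNorm_nonneg)

theorem sobolevQuotient_nonneg (A : E3 → E3) : 0 ≤ sobolevQuotient A :=
  div_nonneg (Real.rpow_nonneg lpNorm_nonneg _) (Real.rpow_nonneg (gaugeSeminorm_nonneg A) _)

theorem sobolevConst_nonneg : 0 ≤ sobolevConst :=
  Real.sInf_nonneg (by rintro _ ⟨A, -, -, rfl⟩; exact sobolevQuotient_nonneg A)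

theorem memY_of_mem_curlGraph {p : Lp E3 3 (volume : Measure E3) × Lp E3 (3 / 2) (volume : Measure E3)}
    (hp : p ∈ curlGraph) : MemY p.1 :=
  ⟨Lp.memLp p.1, p.2, Lp.memLp p.2, mem_curlGraph_iff.1 hp⟩

theorem weakCurl_ae_eq_of_mem_curlGraph
    {p : Lp E3 3 (volume : Measure E3) × Lp E3 (3 / 2) (volume : Measure E3)} (hp : p ∈ curlGraph) :
    weakCurl p.1 =ᵐ[volume] p.2 :=
  (mem_curlGraph_iff.1 hp).weakCurl.ae_eq (mem_curlGraph_iff.1 hp)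

/-- The Sobolev inequality in product form. Fields at distance 0 from the gradients, excluded from
the infimum, satisfy it trivially. -/
theorem sobolevConst_mul_le {p : Lp E3 3 (volume : Measure E3) × Lp E3 (3 / 2) (volume : Measure E3)}
    (hp : p ∈ curlGraph) :
    sobolevConst * Metric.infDist p.1 gradientSubmodule ^ (3 / 2 : ℝ) ≤ ‖p.2‖ ^ (3 / 2 : ℝ) := by
  rcases (Metric.infDist_nonneg (x := p.1) (s := gradientSubmodule)).eq_or_lt with h | h
  · rw [← h, Real.zero_rpow (by norm_num), mul_zero]
    positivity
  have hY := memY_of_mem_curlGraph hp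
  have hg : gaugeSeminorm p.1 = Metric.infDist p.1 gradientSubmodule := by
    rw [gaugeSeminorm_eq_infDist (Lp.memLp p.1), Lp.toLp_coeFn]
  have hn : lpNorm (weakCurl p.1) (3 / 2) volume = ‖p.2‖ := by
    rw [lpNorm_eq_norm_toLp hY.memLp_weakCurl, Lp.norm_toLp, Lp.norm_def,
      eLpNorm_congr_ae (weakCurl_ae_eq_of_mem_curlGraph hp)]
  rw [← le_div_iff₀ (by positivity), ← hg, ← hn]
  exact csInf_le ⟨0, by rintro _ ⟨A, -, -, rfl⟩; exact sobolevQuotient_nonneg A⟩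
    ⟨p.1, hY, by rw [hg]; exact h.ne', rfl⟩

end CurlSobolev

/-! ### From pairs in L³ × L^{3/2} to vector fields, and conclusion -/

/-- The representative of least norm modulo the closure of `K`. -/
theorem exists_norm_eq_infDist {α E : Type*} [MeasurableSpace α] {μ : Measure α}
    [NormedAddCommGroup E] [InnerProductSpace ℝ E] [CompleteSpace E]
    {Γ : Submodule ℝ (Lp E 3 μ × Lp E (3 / 2) μ)}
    (hΓ : IsClosed (Γ : Set (Lp E 3 μ × Lp E (3 / 2) μ))) {K : Submodule ℝ (Lp E 3 μ)}
    (hK : ∀ g ∈ K, (g, 0) ∈ Γ) {p : Lp E 3 μ × Lp E (3 / 2) μ} (hp : p ∈ Γ) :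
    ∃ v, (v, p.2) ∈ Γ ∧ ‖v‖ = Metric.infDist p.1 K ∧ ∀ g ∈ K, lpInner (dualL3 v) g = 0 := by
  obtain ⟨g₀, hg₀, hnear⟩ := exists_mem_closure_norm_sub_eq_infDist K p.1
  have hmem : (g₀, (0 : Lp E (3 / 2) μ)) ∈ Γ :=
    closure_minimal (t := (fun g : Lp E 3 μ => (g, (0 : Lp E (3 / 2) μ))) ⁻¹' Γ) hK
      (hΓ.preimage (by fun_prop)) hg₀
  refine ⟨p.1 - g₀, by simpa [Prod.sub_def] using Γ.sub_mem hp hmem, hnear, fun g hg =>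
    lpInner_dualL3_eq_zero (K := K) (fun g hg => ?_) hg⟩
  rw [hnear, ← Metric.infDist_closure, show p.1 - g₀ + g = p.1 - (g₀ - g) by abel, ← dist_eq_norm]
  exact Metric.infDist_le_dist_of_mem
    (K.topologicalClosure.sub_mem hg₀ (K.le_topologicalClosure hg))

namespace CurlSobolev

/-- Translation of approximate critical points in `L³ × L^{3/2}` to vector fields. -/
theorem exists_fields_of_exists_mem_curlGraph {A : ℕ → E3 → E3} (hA : ∀ n, MemY (A n))
    {a b : ℕ → ℝ} (ha : Tendsto a atTop (𝓝 0)) (hb : Tendsto b atTop (𝓝 0))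
    (h : ∀ n, ∃ p ∈ curlGraph, ∃ r : Lp E3 3 (volume : Measure E3), ‖p.1‖ = 1 ∧
      (∀ g ∈ gradientSubmodule, lpInner (dualL3 p.1) g = 0) ∧
      ‖p.2 - (hA n).memLp_weakCurl.toLp‖ ≤ a n ∧ ‖r‖ ≤ b n ∧
      ∀ q ∈ curlGraph, lpInner q.2 (dualL32 p.2) - sobolevConst * lpInner (dualL3 p.1) q.1
        = lpInner q.2 r) :
    ∃ A' r : ℕ → E3 → E3,
      (∀ n, MemY (A' n) ∧ WeaklyDivFree (fun x => ‖A' n x‖ • A' n x) ∧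
        lpNorm (A' n) 3 volume = 1) ∧
      Tendsto (fun n => eLpNorm (weakCurl (A' n) - weakCurl (A n)) (3 / 2) volume) atTop (𝓝 0) ∧
      (∀ n, MemLp (r n) 3 volume) ∧
      Tendsto (fun n => eLpNorm (r n) 3 volume) atTop (𝓝 0) ∧
      ∀ n, ∀ Φ : E3 → E3, IsTest Φ →
        (∫ x, inner ℝ (‖weakCurl (A' n) x‖ ^ (-(1 / 2) : ℝ) • weakCurl (A' n) x) (curl Φ x)) -
          sobolevConst * ∫ x, inner ℝ (‖A' n x‖ • A' n x) (Φ x) =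
        ∫ x, inner ℝ (r n x) (curl Φ x) := by
  choose p hp r h1 horth hpA hr heq using h
  have hcurl := fun n => weakCurl_ae_eq_of_mem_curlGraph (hp n)
  have hofReal : ∀ {u : ℕ → ℝ}, Tendsto u atTop (𝓝 0) →
      Tendsto (fun n => ENNReal.ofReal (u n)) atTop (𝓝 0) := fun hu => by
    simpa using ENNReal.tendsto_ofReal hu
  refine ⟨fun n => (p n).1, fun n => r n, fun n => ⟨memY_of_mem_curlGraph (hp n), ⟨?_, ?_⟩, ?_⟩,
    ?_, fun n => Lp.memLp (r n), ?_, fun n Φ hΦ => ?_⟩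
  · exact (memLp_norm_smul (Lp.memLp (p n).1)).locallyIntegrable Fact.out
  · intro η hη
    have hg := hη.isTest_gradient.memLp 3
    -- Gradients of test functions belong to the gradient subspace, so orthogonality to it contains
    -- the weak divergence condition.
    have := horth n hg.toLp ⟨η, hη.hasWeakGradient.congr_ae hg.coeFn_toLp.symm⟩
    rw [lpInner_toLp_right hg] at this
    rw [← this]
    exact integral_congr_ae ((coeFn_dualL3 (p n).1).mono fun x hx => by simp only [hx])
  · rw [lpNorm_eq_norm_toLp (Lp.memLp _), Lp.toLp_coeFn, h1]
  · refine tendsto_of_tendsto_of_tendsto_of_le_of_le tendsto_const_nhds (hofReal ha)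
      (fun _ => zero_le) fun n => ?_
    have e : weakCurl (p n).1 - weakCurl (A n) =ᵐ[volume]
        ((p n).2 - (hA n).memLp_weakCurl.toLp : Lp E3 (3 / 2) (volume : Measure E3)) := by
      filter_upwards [hcurl n, (hA n).memLp_weakCurl.coeFn_toLp,
        Lp.coeFn_sub (p n).2 (hA n).memLp_weakCurl.toLp] with x e1 e2 e3
      simp only [Pi.sub_apply, e1, e2, e3]
    simp only [eLpNorm_congr_ae e]
    rw [← Lp.enorm_def, ← ofReal_norm]
    exact ENNReal.ofReal_le_ofReal (hpA n)
  · refine tendsto_of_tendsto_of_tendsto_of_le_of_le tendsto_const_nhds (hofReal hb)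
      (fun _ => zero_le) fun n => ?_
    simp only [← Lp.enorm_def, ← ofReal_norm]
    exact ENNReal.ofReal_le_ofReal (hr n)
  -- The distributional equation is the identity on the graph, tested with the pair (Φ, curl Φ).
  · have := heq n _ (hΦ.hasWeakCurl.mem_curlGraph (hΦ.memLp 3) (hΦ.isTest_curl.memLp (3 / 2)))
    rw [lpInner_toLp_left, lpInner_toLp_left, lpInner_toLp_right] at this
    rw [← this]
    congr 1
    · refine integral_congr_ae ?_
      filter_upwards [hcurl n, coeFn_dualL32 (p n).2] with x e1 e2
      rw [e1, e2]
    · congr 1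
      exact integral_congr_ae ((coeFn_dualL3 (p n).1).mono fun x hx => by simp only [hx])

end CurlSobolev

theorem proposition8 (A : ℕ → CurlSobolev.E3 → CurlSobolev.E3)
    (hA : CurlSobolev.IsMinimizingSeq A)
    (hnorm : ∀ n, CurlSobolev.gaugeSeminorm (A n) = 1) :
    ∃ A' r : ℕ → CurlSobolev.E3 → CurlSobolev.E3,
      (∀ n, CurlSobolev.MemY (A' n) ∧
        CurlSobolev.WeaklyDivFree (fun x => ‖A' n x‖ • A' n x) ∧
        lpNorm (A' n) 3 volume = 1) ∧
      Tendsto (fun n => eLpNorm (CurlSobolev.weakCurl (A' n) - CurlSobolev.weakCurl (A n))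
        (3 / 2) volume) atTop (𝓝 0) ∧
      (∀ n, MemLp (r n) 3 volume) ∧
      Tendsto (fun n => eLpNorm (r n) 3 volume) atTop (𝓝 0) ∧
      ∀ n, ∀ Φ : CurlSobolev.E3 → CurlSobolev.E3, CurlSobolev.IsTest Φ →
        (∫ x, inner ℝ (‖CurlSobolev.weakCurl (A' n) x‖ ^ (-(1 / 2) : ℝ) •
            CurlSobolev.weakCurl (A' n) x) (CurlSobolev.curl Φ x)) -
          CurlSobolev.sobolevConst * ∫ x, inner ℝ (‖A' n x‖ • A' n x) (Φ x) =
        ∫ x, inner ℝ (r n x) (CurlSobolev.curl Φ x) := by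
  have hY := fun n => (hA.1 n).1
  set B : ℕ → Lp CurlSobolev.E3 (3 / 2) (volume : Measure CurlSobolev.E3) :=
    fun n => (hY n).memLp_weakCurl.toLp
  have hmem : ∀ n, ((hY n).1.toLp, B n) ∈ CurlSobolev.curlGraph := fun n =>
    (hY n).hasWeakCurl.mem_curlGraph (hY n).1 (hY n).memLp_weakCurl
  have hdist : ∀ n, Metric.infDist (hY n).1.toLp CurlSobolev.gradientSubmodule = 1 := fun n => by
    rw [← CurlSobolev.gaugeSeminorm_eq_infDist, hnorm]
  have hlim : Tendsto (fun n => ‖B n‖ ^ (3 / 2 : ℝ)) atTop (𝓝 CurlSobolev.sobolevConst) := by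
    refine hA.2.congr fun n => ?_
    rw [CurlSobolev.sobolevQuotient, hnorm, Real.one_rpow, div_one,
      CurlSobolev.lpNorm_eq_norm_toLp (hY n).memLp_weakCurl]
  -- Positivity of S is not needed. If S = 0, the curls tend to 0 in L^{3/2}, so minimal
  -- representatives work with `dualL32 (B n)` as the remainder.
  rcases CurlSobolev.sobolevConst_nonneg.eq_or_lt with hS | hS
  · rw [← hS] at hlim
    have hlim' : Tendsto (fun n => ‖dualL32 (B n)‖) atTop (𝓝 0) := by
      have := hlim.rpow_const (p := 1 / 3) (Or.inr (by norm_num))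
      rw [Real.zero_rpow (by norm_num)] at this
      refine this.congr fun n => ?_
      rw [← norm_dualL32_pow_three, ← Real.rpow_natCast, ← Real.rpow_mul (norm_nonneg _)]
      norm_num
    refine CurlSobolev.exists_fields_of_exists_mem_curlGraph hY tendsto_const_nhds hlim' fun n => ?_
    obtain ⟨v, hv, hv1, hv2⟩ := exists_norm_eq_infDist CurlSobolev.isClosed_curlGraph
      (fun g => CurlSobolev.prod_zero_mem_curlGraph) (hmem n)
    refine ⟨_, hv, dualL32 (B n), hv1.trans (hdist n), hv2, ?_, le_rfl, fun q _ => ?_⟩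
    · simp [B]
    · rw [← hS]; simp
  · set η : ℕ → ℝ := fun n => ‖B n‖ ^ (3 / 2 : ℝ) - CurlSobolev.sobolevConst with hη
    have hη0 : ∀ n, 0 ≤ η n := fun n => by
      have := CurlSobolev.sobolevConst_mul_le (hmem n)
      rw [hdist, Real.one_rpow, mul_one] at this
      exact sub_nonneg.2 this
    have hηlim : Tendsto η atTop (𝓝 0) := by simpa using hlim.sub_const CurlSobolev.sobolevConst
    have hsqrt : Tendsto (fun n => √(η n)) atTop (𝓝 0) := by simpa using hηlim.sqrt
    -- The term √η gives η/δ ≤ √η → 0, the term 2η ensures 2η ≤ δ, and 1/(n + 1) keeps δ positive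
    -- when η = 0.
    set δ : ℕ → ℝ := fun n => √(η n) + 2 * η n + 1 / ((n : ℝ) + 1)
    have hδlim : Tendsto δ atTop (𝓝 0) := by
      simpa [δ] using (hsqrt.add (hηlim.const_mul 2)).add tendsto_one_div_add_atTop_nhds_zero_nat
    have hpos : ∀ n : ℕ, 0 < 1 / ((n : ℝ) + 1) := fun n => by positivity
    have hδ : ∀ n, 0 < δ n := fun n => by
      have := hη0 n; have := hpos n; positivity
    have hquot : ∀ n, η n / δ n ≤ √(η n) := fun n => by
      rw [div_le_iff₀ (hδ n)]
      nth_rw 1 [← Real.mul_self_sqrt (hη0 n)]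
      gcongr
      linarith [hη0 n, hpos n, Real.sqrt_nonneg (η n), show δ n = √(η n) + 2 * η n
        + 1 / ((n : ℝ) + 1) from rfl]
    have hBlim : Tendsto (fun n => ‖B n‖) atTop
        (𝓝 (CurlSobolev.sobolevConst ^ (2 / 3 : ℝ))) := by
      refine (hlim.rpow_const (p := 2 / 3) (Or.inr (by norm_num))).congr fun n => ?_
      rw [← Real.rpow_mul (norm_nonneg _)]
      norm_num
    have hα : Tendsto (fun n => (2 * ‖B n‖ + 3) * √(η n)) atTop (𝓝 0) := by
      simpa using ((hBlim.const_mul 2).add_const 3).mul hsqrt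
    have hβ := hδlim.const_mul (2 * ((1 / CurlSobolev.sobolevConst) ^ (2 / 3 : ℝ) + 1))
    rw [mul_zero] at hβ
    refine CurlSobolev.exists_fields_of_exists_mem_curlGraph hY hα hβ fun n => ?_
    obtain ⟨p, hp, r, h1, h2, h3, h4, h5⟩ := exists_almost_critical CurlSobolev.isClosed_curlGraph
      (fun g => CurlSobolev.prod_zero_mem_curlGraph) hS
      (fun p => CurlSobolev.sobolevConst_mul_le) (hmem n) (hdist n) (η := η n) (δ := δ n)
      (by simp [hη]) (hδ n) (by
        have := hpos n
        have := Real.sqrt_nonneg (η n)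
        simp only [δ]
        linarith)
    exact ⟨p, hp, r, h1, h2, h3.trans (by gcongr; exact hquot n), h4, h5⟩

end
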